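/- Let $(\theta_j)_{j\ge1}$, $(\kappa_j)_{j\ge1}$ be sequences of non-negative reals. For $N\in\mathbb N$ consider the surrogate-spatial measure on the symmetric group $\mathfrak S_N$ (permutations of $1,\dots,N$), $$\tilde{\mathbb P}_N(\sigma)=\frac{1}{N!\,H_N}\prod_{j=1}^N(\theta_j+N\kappa_j)^{C_j(\sigma)},\qquad H_N=\frac1{N!}\sum_{\sigma\in\mathfrak S_N}\prod_{j=1}^N(\theta_j+N\kappa_j)^{C_j(\sigma)},$$ where $C_j(\sigma)$ is the number of cycles of length $j$ of $\sigma$. Let $L_1$ be the length of the cycle containing $1$, $L_2$ the length of the cycle containing the smallest element not in that cycle, and so on ($L_j:=0$ if there are fewer than $j$ cycles). Put $g_\theta(z)=\sum_{j\ge1}\frac{\theta_j}{j}z^j$, $g_\kappa(z)=\sum_{j\ge1}\frac{\kappa_j}{j}z^j$, $g^{\{n\}}(z)=z^n\frac{d^ng}{dz^n}(z)$, let $R\in(0,\infty]$ be the radius of convergence of $g_\kappa$, assume that the radius of convergence of $g_\theta$ is at least $R$, and set $g^{\{n\}}(R)=\lim_{r\uparrow R}g^{\{n\}}(r)\in[0,\infty]$.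 Assume that no integer $j_0>1$ divides all $j$ with $\kappa_j\neq0$, and that $\kappa_j>0$ for some $j\ge2$. For finite $R$, $\eta>0$ and $0<\varphi<\pi/2$ let $$\Delta_0=\{z\in\mathbb C: |z|<R\,|1+\eta e^{i\varphi}|,\ z\ne R,\ |\arg(z-R)|>\varphi\}.$$ Assume that one of the following six conditions holds (in 2–6, $R<\infty$; in 2, 3, 5, 6, $g_\theta$ and $g_\kappa$ extend holomorphically to some such $\Delta_0$, the expansions hold as $z\to R$ in $\Delta_0$ for some $\delta>0$, and we write $u=1-z/R$): 1. (subcritical) $1<g_\kappa^{\{1\}}(R)\le\infty$. 2. (supercritical) $g_\kappa^{\{1\}}(R)<1$; for some $\theta^*>0$, $g_\theta(z)=-\theta^*\log u+O(u^\delta)$, and $g_\kappa(z)=g_\kappa(R)-g_\kappa^{\{1\}}(R)u+O(u^{1+\delta})$. 3. (supercritical) $g_\kappa^{\{1\}}(R)<1$; $g_\theta$ is regular at $z=R$; for some non-integer $s>1$ and real $a_s\ne0$, $g_\kappa^{\{n\}}(R)$ is finite for $n<s$ and infinite for $n>s$, and $g_\kappa(z)=\sum_{0\le n<s}\frac{(-1)^ng_\kappa^{\{n\}}(R)}{n!}u^n+a_su^s+O(u^{s+\delta})$.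 4. (critical) $g_\kappa^{\{1\}}(R)=1$, $g_\theta(R)<\infty$, $g_\kappa(R)<\infty$, $0<g_\kappa^{\{2\}}(R)<\infty$. 5. (critical) $g_\kappa^{\{1\}}(R)=1$, $0<g_\kappa^{\{2\}}(R)<\infty$; for some $\theta^*\ge0$, $g_\theta(z)=-\theta^*\log u+O(u^\delta)$, and $g_\kappa(z)=g_\kappa(R)-u+\frac12g_\kappa^{\{2\}}(R)u^2+O(u^{2+\delta})$. 6. (critical) $g_\kappa^{\{1\}}(R)=1$; for some $\theta^*\ge0$, $s\in(1,2)$, $a_s>0$, $g_\theta(z)=-\theta^*\log u+O(u^\delta)$ and $g_\kappa(z)=g_\kappa(R)-u+a_su^s+O(u^{s+\delta})$. Then $H_N>0$ for all large $N$, and there is exactly one real $r_*>0$, $r_*\le R$, such that $g_\kappa^{\{1\}}(r_*)=1$ if $g_\kappa^{\{1\}}(R)\ge1$, and $r_*=R$ if $g_\kappa^{\{1\}}(R)<1$. For every $m\ge1$ the following hold. (a) For all $\ell_1,\dots,\ell_m\in\mathbb N$, without any normalization, $$\lim_{N\to\infty}\tilde{\mathbb P}_N\{L_1=\ell_1,\dots,L_m=\ell_m\}=\prod_{j=1}^m\kappa_{\ell_j}r_*^{\ell_j}.$$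 (b) $L_1,\dots,L_m$ are asymptotically independent in the following sense. For every $M$ such that $\kappa_j>0$ for some $j\le M$, they are asymptotically independent conditionally on the event $E_M=\{L_1\le M,\dots,L_m\le M\}$: for all $\ell_1,\dots,\ell_m\in\mathbb N$, $$\tilde{\mathbb P}_N\{L_1=\ell_1,\dots,L_m=\ell_m\mid E_M\}-\prod_{j=1}^m\tilde{\mathbb P}_N\{L_j=\ell_j\mid E_M\}\to0\qquad(N\to\infty).$$ If $g_\kappa^{\{1\}}(R)\ge1$, they are also unconditionally asymptotically independent: for all sets $A_1,\dots,A_m\subseteq\{0,1,2,\dots\}$, $\tilde{\mathbb P}_N\{L_1\in A_1,\dots,L_m\in A_m\}-\prod_{j=1}^m\tilde{\mathbb P}_N\{L_j\in A_j\}\to0$. (c) If $g_\kappa^{\{1\}}(R)\ge1$, the limit in (a) is a proper probability distribution on $\mathbb N^m$ (total mass $1$); if $g_\kappa^{\{1\}}(R)<1$, it is defective, with total mass $\bigl(g_\kappa^{\{1\}}(R)\bigr)^m<1$. -/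

import Mathlib

open Filter Topology Asymptotics
open scoped ENNReal

noncomputable section

namespace SurrogateSpatial

/-! ### The surrogate-spatial measure on permutations -/

/-- The number `C_j(σ)` of cycles of length `j` of `σ` (fixed points are cycles of length one). -/
def cycleCount {N : ℕ} (σ : Equiv.Perm (Fin N)) (j : ℕ) : ℕ :=
  σ.partition.parts.count j

/-- The unnormalized weight `∏_{j=1}^N (θ_j + N κ_j)^{C_j(σ)}`. -/
def cycleWeight (θ κ : ℕ → ℝ) (N : ℕ) (σ : Equiv.Perm (Fin N)) : ℝ :=
  ∏ j ∈ Finset.Icc 1 N, (θ j + N * κ j) ^ cycleCount σ j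

/-- The normalization `H_N = (1 / N!) ∑_σ ∏_j (θ_j + N κ_j)^{C_j(σ)}`. -/
def normConst (θ κ : ℕ → ℝ) (N : ℕ) : ℝ :=
  (1 / (N.factorial : ℝ)) * ∑ σ : Equiv.Perm (Fin N), cycleWeight θ κ N σ

/-- The mass of the single permutation `σ` (meaningful when `H_N > 0`). -/
def permMass (θ κ : ℕ → ℝ) (N : ℕ) (σ : Equiv.Perm (Fin N)) : ℝ :=
  cycleWeight θ κ N σ / ((N.factorial : ℝ) * normConst θ κ N)

open Classical in
/-- The probability of the event `A`. -/
def prob (θ κ : ℕ → ℝ) (N : ℕ) (A : Set (Equiv.Perm (Fin N))) : ℝ :=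
  ∑ σ : Equiv.Perm (Fin N), if σ ∈ A then permMass θ κ N σ else 0

/-- The elementary conditional probability of `A` given `B`. -/
def condProb (θ κ : ℕ → ℝ) (N : ℕ) (A B : Set (Equiv.Perm (Fin N))) : ℝ :=
  prob θ κ N (A ∩ B) / prob θ κ N B

/-! ### Lexicographically ordered cycle lengths -/

open Classical in
/-- The set of elements that remain after the first `k` lexicographically ordered cycles have been
removed: at each step one removes the cycle containing the smallest remaining element. -/
def remaining {N : ℕ} (σ : Equiv.Perm (Fin N)) : ℕ → Finset (Fin N)
  | 0 => Finset.univ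
  | k + 1 =>
    if h : (remaining σ k).Nonempty then
      (remaining σ k).filter fun x => ¬ σ.SameCycle ((remaining σ k).min' h) x
    else ∅

open Classical in
/-- The length `L_{k+1}(σ)` of the `(k+1)`-st cycle in the lexicographic order, that is, of the cycle
containing the smallest element that lies in none of the first `k` cycles; it is `0` if `σ` has at
most `k` cycles. -/
def lexLength {N : ℕ} (σ : Equiv.Perm (Fin N)) (k : ℕ) : ℕ :=
  if h : (remaining σ k).Nonempty then
    (Finset.univ.filter fun x => σ.SameCycle ((remaining σ k).min' h) x).card
  else 0

/-! ### Generating functions -/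

/-- The coefficients of `g_a(z) = ∑_{j ≥ 1} (a_j / j) z^j`. -/
def genCoeff (a : ℕ → ℝ) (j : ℕ) : ℝ := if j = 0 then 0 else a j / j

/-- The radius of convergence of `g_a`. -/
def genRadius (a : ℕ → ℝ) : ℝ≥0∞ :=
  (FormalMultilinearSeries.ofScalars ℂ fun j => ((genCoeff a j : ℝ) : ℂ)).radius

/-- The sum `g_a(z)` of the series (meaningful inside the disk of convergence). -/
def genFun (a : ℕ → ℝ) (z : ℂ) : ℂ := ∑' j : ℕ, ((genCoeff a j : ℝ) : ℂ) * z ^ j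

/-- The modified derivative `g_a^{\{n\}}(r) = r^n g_a^{(n)}(r)` at a point `r` of `[0, R]`, where `R` is
the radius of convergence, as an element of `[0, ∞]`.  For `a ≥ 0` it is the sum of the termwise
differentiated series; by monotone convergence its value at `r = R` (also if `R = ∞`) is the limit
of `g_a^{\{n\}}(r)` as `r ↑ R`. -/
def modDeriv (a : ℕ → ℝ) (n : ℕ) (r : ℝ≥0∞) : ℝ≥0∞ :=
  ∑' j : ℕ, (j.descFactorial n : ℝ≥0∞) * ENNReal.ofReal (genCoeff a j) * r ^ j

/-- Non-arithmetic: there is no integer `j₀ > 1` that divides all `j ≥ 1` with `κ_j ≠ 0`. -/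
def NonArithmetic (κ : ℕ → ℝ) : Prop :=
  ¬ ∃ j₀ : ℕ, 1 < j₀ ∧ ∀ j : ℕ, 1 ≤ j → κ j ≠ 0 → j₀ ∣ j

/-- `r = r_*`: the root in `(0, R]` of `g_κ^{\{1\}}(r) = 1` if `g_κ^{\{1\}}(R) ≥ 1`, and `r = R`
if `g_κ^{\{1\}}(R) < 1`. -/
def IsRStar (κ : ℕ → ℝ) (r : ℝ) : Prop :=
  0 < r ∧ ENNReal.ofReal r ≤ genRadius κ ∧
    (1 ≤ modDeriv κ 1 (genRadius κ) → modDeriv κ 1 (ENNReal.ofReal r) = 1) ∧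
    (modDeriv κ 1 (genRadius κ) < 1 → ENNReal.ofReal r = genRadius κ)

/-! ### Analytic conditions -/

/-- The domain `Δ₀(R, η, φ)`: a disk of radius larger than `R` with a sector at `R` cut out. -/
def deltaDomain (R η φ : ℝ) : Set ℂ :=
  {z : ℂ | ‖z‖ < ‖(R : ℂ) * (1 + η * Complex.exp (Complex.I * φ))‖ ∧ z ≠ (R : ℂ) ∧
    φ < |Complex.arg (z - R)|}

/-- `F` is a holomorphic continuation to `D` of `g_a`, given by its series in `|z| < R`. -/
def ContinuesTo (a : ℕ → ℝ) (R : ℝ) (D : Set ℂ) (F : ℂ → ℂ) : Prop :=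
  ENNReal.ofReal R ≤ genRadius a ∧ DifferentiableOn ℂ F D ∧ ∀ z : ℂ, ‖z‖ < R → F z = genFun a z

/-- `F(z) = -θ* log(1 - z/R) + O((1 - z/R)^δ)` as `z → R`, `z ∈ D`. -/
def LogExpansion (F : ℂ → ℂ) (R : ℝ) (D : Set ℂ) (θs δ : ℝ) : Prop :=
  (fun z : ℂ => F z - (-(θs : ℂ) * Complex.log (1 - z / R))) =O[𝓝[D] (R : ℂ)]
    fun z : ℂ => ‖1 - z / R‖ ^ δ

/-- Subcritical case: `1 < g_κ^{\{1\}}(R) ≤ ∞` (here `R = ∞` is allowed). -/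
def Subcritical (θ κ : ℕ → ℝ) : Prop :=
  0 < genRadius κ ∧ genRadius κ ≤ genRadius θ ∧ 1 < modDeriv κ 1 (genRadius κ)

/-- Supercritical case with a logarithmic singularity of `g_θ`. -/
def SupercriticalLog (θ κ : ℕ → ℝ) : Prop :=
  ∃ (R η φ θs δ : ℝ) (Fθ Fκ : ℂ → ℂ),
    0 < R ∧ genRadius κ = ENNReal.ofReal R ∧
    0 < η ∧ 0 < φ ∧ φ < Real.pi / 2 ∧ 0 < θs ∧ 0 < δ ∧
    ContinuesTo θ R (deltaDomain R η φ) Fθ ∧ ContinuesTo κ R (deltaDomain R η φ) Fκ ∧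
    modDeriv κ 1 (ENNReal.ofReal R) < 1 ∧
    LogExpansion Fθ R (deltaDomain R η φ) θs δ ∧
    (fun z : ℂ => Fκ z - ((modDeriv κ 0 (ENNReal.ofReal R)).toReal
        - (modDeriv κ 1 (ENNReal.ofReal R)).toReal * (1 - z / R)))
      =O[𝓝[deltaDomain R η φ] (R : ℂ)] fun z : ℂ => ‖1 - z / R‖ ^ (1 + δ)

/-- Supercritical case with `g_θ` regular at `R` and a power singularity of `g_κ` of non-integer
order `s > 1`. -/
def SupercriticalPower (θ κ : ℕ → ℝ) : Prop :=
  ∃ (R η φ s as δ : ℝ) (Fθ Fκ : ℂ → ℂ),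
    0 < R ∧ genRadius κ = ENNReal.ofReal R ∧
    0 < η ∧ 0 < φ ∧ φ < Real.pi / 2 ∧ 0 < δ ∧
    1 < s ∧ (∀ k : ℕ, s ≠ k) ∧ as ≠ 0 ∧
    ContinuesTo θ R (deltaDomain R η φ) Fθ ∧ AnalyticAt ℂ Fθ (R : ℂ) ∧
    ContinuesTo κ R (deltaDomain R η φ) Fκ ∧
    modDeriv κ 1 (ENNReal.ofReal R) < 1 ∧
    (∀ n : ℕ, (n : ℝ) < s → modDeriv κ n (ENNReal.ofReal R) < ∞) ∧
    (∀ n : ℕ, s < (n : ℝ) → modDeriv κ n (ENNReal.ofReal R) = ∞) ∧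
    (fun z : ℂ => Fκ z
        - (∑ n ∈ Finset.range ⌈s⌉₊,
            (-1 : ℂ) ^ n * ((modDeriv κ n (ENNReal.ofReal R)).toReal : ℂ) / (n.factorial : ℂ)
              * (1 - z / R) ^ n
          + (as : ℂ) * (1 - z / R) ^ (s : ℂ)))
      =O[𝓝[deltaDomain R η φ] (R : ℂ)] fun z : ℂ => ‖1 - z / R‖ ^ (s + δ)

/-- Critical case with `g_θ(R) < ∞` and finite second derivative of `g_κ` at `R`. -/
def CriticalRegular (θ κ : ℕ → ℝ) : Prop :=
  ∃ R : ℝ, 0 < R ∧ genRadius κ = ENNReal.ofReal R ∧ ENNReal.ofReal R ≤ genRadius θ ∧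
    modDeriv θ 0 (ENNReal.ofReal R) < ∞ ∧ modDeriv κ 0 (ENNReal.ofReal R) < ∞ ∧
    modDeriv κ 1 (ENNReal.ofReal R) = 1 ∧
    0 < modDeriv κ 2 (ENNReal.ofReal R) ∧ modDeriv κ 2 (ENNReal.ofReal R) < ∞

/-- Critical case with a (possibly absent) logarithmic singularity of `g_θ` and finite second
derivative of `g_κ` at `R`. -/
def CriticalLog (θ κ : ℕ → ℝ) : Prop :=
  ∃ (R η φ θs δ : ℝ) (Fθ Fκ : ℂ → ℂ),
    0 < R ∧ genRadius κ = ENNReal.ofReal R ∧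
    0 < η ∧ 0 < φ ∧ φ < Real.pi / 2 ∧ 0 ≤ θs ∧ 0 < δ ∧
    ContinuesTo θ R (deltaDomain R η φ) Fθ ∧ ContinuesTo κ R (deltaDomain R η φ) Fκ ∧
    modDeriv κ 1 (ENNReal.ofReal R) = 1 ∧
    0 < modDeriv κ 2 (ENNReal.ofReal R) ∧ modDeriv κ 2 (ENNReal.ofReal R) < ∞ ∧
    LogExpansion Fθ R (deltaDomain R η φ) θs δ ∧
    (fun z : ℂ => Fκ z - ((modDeriv κ 0 (ENNReal.ofReal R)).toReal - (1 - z / R)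
        + (modDeriv κ 2 (ENNReal.ofReal R)).toReal / 2 * (1 - z / R) ^ 2))
      =O[𝓝[deltaDomain R η φ] (R : ℂ)] fun z : ℂ => ‖1 - z / R‖ ^ (2 + δ)

/-- Critical case with a (possibly absent) logarithmic singularity of `g_θ` and a power singularity
of `g_κ` of order `s ∈ (1, 2)`. -/
def CriticalPower (θ κ : ℕ → ℝ) : Prop :=
  ∃ (R η φ θs s as δ : ℝ) (Fθ Fκ : ℂ → ℂ),
    0 < R ∧ genRadius κ = ENNReal.ofReal R ∧
    0 < η ∧ 0 < φ ∧ φ < Real.pi / 2 ∧ 0 ≤ θs ∧ 0 < δ ∧ 1 < s ∧ s < 2 ∧ 0 < as ∧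
    ContinuesTo θ R (deltaDomain R η φ) Fθ ∧ ContinuesTo κ R (deltaDomain R η φ) Fκ ∧
    modDeriv κ 1 (ENNReal.ofReal R) = 1 ∧
    LogExpansion Fθ R (deltaDomain R η φ) θs δ ∧
    (fun z : ℂ => Fκ z - ((modDeriv κ 0 (ENNReal.ofReal R)).toReal - (1 - z / R)
        + (as : ℂ) * (1 - z / R) ^ (s : ℂ)))
      =O[𝓝[deltaDomain R η φ] (R : ℂ)] fun z : ℂ => ‖1 - z / R‖ ^ (s + δ)

/-- The standing analytic hypothesis: one of the six sets of conditions holds. -/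
def AnalyticConditions (θ κ : ℕ → ℝ) : Prop :=
  Subcritical θ κ ∨ SupercriticalLog θ κ ∨ SupercriticalPower θ κ ∨
    CriticalRegular θ κ ∨ CriticalLog θ κ ∨ CriticalPower θ κ

end SurrogateSpatial

end

/-
The normalization satisfies a crude exponential growth law: `(1 / N) log H_N` converges to
`g_κ(r_*) - log r_*`, which is all the information about the singularities of `g_θ` and `g_κ` that
the theorem needs. Tilting finitely many `κ_l` turns moment generating functions of cycle counts
into quotients of such normalizations, so by convexity `C_l / N` concentrates at `κ_l r_*^l / l`.
Since the measure is invariant under conjugation, the joint moments of the `l C_l / N` are, up to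
`O(1 / N)`, the joint law of the lengths of the cycles through `m` given points. The cycles through
the points `1, …, m` are the first `m` cycles in lexicographic order unless two of these points lie
in the same cycle, and a common cycle of bounded length has probability `O(1 / N)`.
-/

noncomputable section

namespace SurrogateSpatial

/-! ### The cycle index -/

/-- The weight `∏_j (w_j / j)^{c_j} / c_j!` of the cycle type `p`, where `c_j` is the number of
parts of `p` equal to `j`. For `p` with sum `N` this is `1 / N!` times the sum of
`∏_j w_j^{C_j(σ)}` over the permutations `σ` of cycle type `p`. A part `0` contributes the factor
`0`, because `w 0 / 0 = 0`. -/
def typeWeight (w : ℕ → ℝ) (p : Multiset ℕ) : ℝ :=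
  ∏ j ∈ p.toFinset, (w j / j) ^ p.count j / (p.count j).factorial

/-- The cycle index of the symmetric group on `N` elements, evaluated at `w`. -/
def cycleIndex (w : ℕ → ℝ) (N : ℕ) : ℝ :=
  ∑ p : N.Partition, typeWeight w p.parts

lemma typeWeight_eq_prod (w : ℕ → ℝ) {p : Multiset ℕ} {s : Finset ℕ} (hs : p.toFinset ⊆ s) :
    typeWeight w p = ∏ j ∈ s, (w j / j) ^ p.count j / (p.count j).factorial := by
  refine Finset.prod_subset hs fun j _ hj => ?_
  rw [Multiset.mem_toFinset] at hj
  simp [Multiset.count_eq_zero_of_notMem hj]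

lemma div_natCast_nonneg {w : ℕ → ℝ} (hw : ∀ j, 1 ≤ j → 0 ≤ w j) (j : ℕ) : 0 ≤ w j / j := by
  rcases j.eq_zero_or_pos with rfl | hj
  · simp
  · exact div_nonneg (hw j hj) j.cast_nonneg

lemma typeWeight_nonneg {w : ℕ → ℝ} (hw : ∀ j, 1 ≤ j → 0 ≤ w j) (p : Multiset ℕ) :
    0 ≤ typeWeight w p :=
  Finset.prod_nonneg fun j _ => div_nonneg (pow_nonneg (div_natCast_nonneg hw j) _) (by positivity)

lemma typeWeight_pos {w : ℕ → ℝ} {p : Multiset ℕ} (hp : ∀ j ∈ p, 1 ≤ j ∧ 0 < w j) :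
    0 < typeWeight w p := by
  refine Finset.prod_pos fun j hj => ?_
  obtain ⟨hj1, hwj⟩ := hp j (Multiset.mem_toFinset.1 hj)
  positivity

lemma typeWeight_mono {w w' : ℕ → ℝ} (hw : ∀ j, 1 ≤ j → 0 ≤ w j)
    (hww' : ∀ j, 1 ≤ j → w j ≤ w' j) (p : Multiset ℕ) : typeWeight w p ≤ typeWeight w' p := by
  refine Finset.prod_le_prod
    (fun j _ => div_nonneg (pow_nonneg (div_natCast_nonneg hw j) _) (by positivity)) fun j _ => ?_
  have hj : w j / j ≤ w' j / j := by
    rcases j.eq_zero_or_pos with rfl | hj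
    · simp
    · exact div_le_div_of_nonneg_right (hww' j hj) j.cast_nonneg
  have := div_natCast_nonneg hw j
  gcongr

lemma pow_div_factorial_mul_le {a b : ℝ} (ha : 0 ≤ a) (hb : 0 ≤ b) (c e : ℕ) :
    a ^ c / c.factorial * (b ^ e / e.factorial) ≤ (a + b) ^ (c + e) / (c + e).factorial := by
  have hterm : a ^ c * b ^ e * (c + e).choose c ≤ (a + b) ^ (c + e) := by
    have h := Finset.single_le_sum (s := Finset.range (c + e + 1))
      (f := fun m => a ^ m * b ^ (c + e - m) * ((c + e).choose m : ℝ))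
      (fun m _ => by positivity) (a := c) (by simp)
    rw [← add_pow] at h
    simpa only [Nat.add_sub_cancel_left] using h
  have hfact : ((c + e).choose c : ℝ) * c.factorial * e.factorial = (c + e).factorial := by
    rw [Nat.choose_symm_add]
    exact_mod_cast Nat.add_choose_mul_factorial_mul_factorial c e
  rw [div_mul_div_comm, div_le_div_iff₀ (by positivity) (by positivity), ← hfact]
  calc a ^ c * b ^ e * (((c + e).choose c : ℝ) * c.factorial * e.factorial)
      = a ^ c * b ^ e * (c + e).choose c * (c.factorial * e.factorial) := by ring
    _ ≤ (a + b) ^ (c + e) * (c.factorial * e.factorial) := by gcongr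

lemma typeWeight_mul_typeWeight_le {w w' : ℕ → ℝ} (hw : ∀ j, 1 ≤ j → 0 ≤ w j)
    (hw' : ∀ j, 1 ≤ j → 0 ≤ w' j) (p q : Multiset ℕ) :
    typeWeight w p * typeWeight w' q ≤ typeWeight (w + w') (p + q) := by
  have hp : p.toFinset ⊆ (p + q).toFinset := Multiset.toFinset_subset.2 (Multiset.subset_of_le
    (Multiset.le_add_right p q))
  have hq : q.toFinset ⊆ (p + q).toFinset := Multiset.toFinset_subset.2 (Multiset.subset_of_le
    (Multiset.le_add_left q p))
  rw [typeWeight_eq_prod w hp, typeWeight_eq_prod w' hq, typeWeight, ← Finset.prod_mul_distrib]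
  refine Finset.prod_le_prod (fun j _ => ?_) fun j _ => ?_
  all_goals have hj := div_natCast_nonneg hw j
  all_goals have hj' := div_natCast_nonneg hw' j
  · positivity
  · rw [Multiset.count_add, Pi.add_apply, add_div]
    exact pow_div_factorial_mul_le hj hj' _ _

lemma typeWeight_mul_pow (w : ℕ → ℝ) (x : ℝ) (p : Multiset ℕ) :
    typeWeight (fun j => w j * x ^ j) p = typeWeight w p * x ^ p.sum := by
  rw [Finset.sum_multiset_count, ← Finset.prod_pow_eq_pow_sum, typeWeight, typeWeight,
    ← Finset.prod_mul_distrib]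
  refine Finset.prod_congr rfl fun j _ => ?_
  rw [mul_div_right_comm, mul_pow, smul_eq_mul, mul_comm (p.count j), pow_mul]
  ring

lemma cycleIndex_mul_pow (w : ℕ → ℝ) (x : ℝ) (N : ℕ) :
    cycleIndex (fun j => w j * x ^ j) N = cycleIndex w N * x ^ N := by
  rw [cycleIndex, cycleIndex, Finset.sum_mul]
  exact Finset.sum_congr rfl fun p _ => by rw [typeWeight_mul_pow, p.parts_sum]

lemma typeWeight_le_cycleIndex {w : ℕ → ℝ} (hw : ∀ j, 1 ≤ j → 0 ≤ w j) {p : Multiset ℕ}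
    (hp : ∀ j ∈ p, 1 ≤ j) : typeWeight w p ≤ cycleIndex w p.sum :=
  Finset.single_le_sum (f := fun q : p.sum.Partition => typeWeight w q.parts)
    (fun q _ => typeWeight_nonneg hw q.parts) (Finset.mem_univ ⟨p, fun h => hp _ h, rfl⟩)

lemma toFinset_parts_subset_range {N : ℕ} (p : N.Partition) :
    p.parts.toFinset ⊆ Finset.range (N + 1) := fun _ hj =>
  Finset.mem_range_succ_iff.2 (p.le_of_mem_parts (Multiset.mem_toFinset.1 hj))

lemma count_parts_le {N : ℕ} (p : N.Partition) (j : ℕ) : p.parts.count j ≤ N := by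
  have hcard : p.parts.card • 1 ≤ p.parts.sum :=
    Multiset.card_nsmul_le_sum fun j hj => p.parts_pos hj
  rw [p.parts_sum, smul_eq_mul, mul_one] at hcard
  exact (Multiset.count_le_card _ _).trans hcard

lemma injective_count_parts (N : ℕ) :
    Function.Injective fun (p : N.Partition) (i : Fin (N + 1)) => p.parts.count (i : ℕ) := by
  intro p q hpq
  ext1
  ext j
  by_cases hj : j ∈ Finset.range (N + 1)
  · exact congrFun hpq ⟨j, Finset.mem_range.1 hj⟩
  · have hcount (p : N.Partition) : p.parts.count j = 0 := Multiset.count_eq_zero_of_notMem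
      fun h => hj (toFinset_parts_subset_range p (Multiset.mem_toFinset.2 h))
    rw [hcount, hcount]

lemma cycleIndex_le_exp {w : ℕ → ℝ} (hw : ∀ j, 1 ≤ j → 0 ≤ w j) (N : ℕ) :
    cycleIndex w N ≤ Real.exp (∑ j ∈ Finset.range (N + 1), w j / j) := by
  let mult (p : N.Partition) (i : Fin (N + 1)) : ℕ := p.parts.count (i : ℕ)
  let term (j c : ℕ) : ℝ := (w j / j) ^ c / c.factorial
  have hterm (j c : ℕ) : 0 ≤ term j c :=
    div_nonneg (pow_nonneg (div_natCast_nonneg hw j) _) (by positivity)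
  have hmem (p : N.Partition) :
      mult p ∈ Fintype.piFinset fun _ : Fin (N + 1) => Finset.range (N + 1) :=
    Fintype.mem_piFinset.2 fun i => Finset.mem_range_succ_iff.2 (count_parts_le p i)
  calc cycleIndex w N
      = ∑ p : N.Partition, ∏ i : Fin (N + 1), term i (mult p i) :=
        Finset.sum_congr rfl fun p _ => by
          rw [typeWeight_eq_prod w (toFinset_parts_subset_range p), Finset.prod_range]
    _ = ∑ c ∈ Finset.univ.image mult, ∏ i : Fin (N + 1), term i (c i) := by
        rw [Finset.sum_image fun _ _ _ _ h => injective_count_parts N h]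
    _ ≤ ∑ c ∈ Fintype.piFinset fun _ : Fin (N + 1) => Finset.range (N + 1),
          ∏ i : Fin (N + 1), term i (c i) :=
        Finset.sum_le_sum_of_subset_of_nonneg (Finset.image_subset_iff.2 fun p _ => hmem p)
          fun c _ _ => Finset.prod_nonneg fun i _ => hterm i (c i)
    _ = ∏ i : Fin (N + 1), ∑ c ∈ Finset.range (N + 1), term i c :=
        (Finset.prod_univ_sum _ _).symm
    _ ≤ ∏ i : Fin (N + 1), Real.exp (w i / (i : ℕ)) :=
        Finset.prod_le_prod (fun i _ => Finset.sum_nonneg fun c _ => hterm i c)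
          fun i _ => Real.sum_le_exp_of_nonneg (div_natCast_nonneg hw i) _
    _ = Real.exp (∑ j ∈ Finset.range (N + 1), w j / j) := by
        rw [Real.exp_sum, Finset.prod_range]

/-! ### Permutations by cycle type -/

lemma prod_factorial_count_add_replicate_one {m : Multiset ℕ} (hm : 1 ∉ m) (c : ℕ) :
    ∏ j ∈ (m + Multiset.replicate c 1).toFinset,
      ((m + Multiset.replicate c 1).count j).factorial =
      c.factorial * ∏ j ∈ m.toFinset, (m.count j).factorial := by
  have hsub : (m + Multiset.replicate c 1).toFinset ⊆ insert 1 m.toFinset := by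
    intro j hj
    rcases Multiset.mem_add.1 (Multiset.mem_toFinset.1 hj) with hj | hj
    · simp [hj]
    · simp [Multiset.eq_of_mem_replicate hj]
  have hcount : ∀ j ∉ (m + Multiset.replicate c 1).toFinset,
      ((m + Multiset.replicate c 1).count j).factorial = 1 := fun j hj => by
    rw [Multiset.count_eq_zero_of_notMem fun h => hj (Multiset.mem_toFinset.2 h),
      Nat.factorial_zero]
  rw [Finset.prod_subset hsub fun j _ => hcount j, Finset.prod_insert (by simpa using hm)]
  congr 1
  · simp [Multiset.count_eq_zero_of_notMem hm]
  · refine Finset.prod_congr rfl fun j hj => ?_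
    have hj1 : 1 ≠ j := fun h => hm (h ▸ Multiset.mem_toFinset.1 hj)
    rw [Multiset.count_add, Multiset.count_replicate, if_neg hj1, add_zero]

lemma parts_eq_add_replicate_one {n : ℕ} (p : n.Partition) :
    p.parts = p.parts.filter (2 ≤ ·) +
      Multiset.replicate (n - (p.parts.filter (2 ≤ ·)).sum) 1 := by
  have hparts := Multiset.filter_add_not (2 ≤ ·) p.parts
  have hones := Multiset.eq_replicate_of_mem (a := 1) (s := p.parts.filter (¬ 2 ≤ ·)) fun j hj => by
    have := p.parts_pos (Multiset.mem_of_mem_filter hj)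
    have := Multiset.of_mem_filter hj
    omega
  have hsum := congrArg Multiset.sum hparts
  rw [hones] at hparts hsum
  rw [Multiset.sum_add, Multiset.sum_replicate, p.parts_sum, smul_eq_mul, mul_one] at hsum
  rw [Nat.sub_eq_of_eq_add' hsum.symm, hparts]

lemma partition_eq_iff_cycleType_eq {α : Type*} [Fintype α] [DecidableEq α] (σ : Equiv.Perm α)
    (p : (Fintype.card α).Partition) :
    σ.partition = p ↔ σ.cycleType = p.parts.filter (2 ≤ ·) := by
  rw [← Equiv.Perm.filter_parts_partition_eq_cycleType]
  refine ⟨fun h => by rw [h], fun h => ?_⟩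
  ext1
  rw [parts_eq_add_replicate_one σ.partition, h, ← parts_eq_add_replicate_one p]

lemma card_partition_eq_mul {α : Type*} [Fintype α] [DecidableEq α]
    (p : (Fintype.card α).Partition) :
    (Finset.univ.filter fun σ : Equiv.Perm α => σ.partition = p).card *
      (p.parts.prod * ∏ j ∈ p.parts.toFinset, (p.parts.count j).factorial) =
      (Fintype.card α).factorial := by
  simp only [partition_eq_iff_cycleType_eq]
  have hparts := parts_eq_add_replicate_one p
  set m := p.parts.filter (2 ≤ ·)
  have hm2 : ∀ j ∈ m, 2 ≤ j := fun j hj => Multiset.of_mem_filter hj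
  have hsum : m.sum ≤ Fintype.card α := by
    have := congrArg Multiset.sum hparts
    rw [Multiset.sum_add, p.parts_sum] at this
    omega
  have hcard := Equiv.Perm.card_of_cycleType_mul_eq α m
  rw [if_pos ⟨hsum, hm2⟩] at hcard
  rw [hparts, prod_factorial_count_add_replicate_one fun h => absurd (hm2 1 h) (by norm_num),
    Multiset.prod_add, Multiset.prod_replicate, one_pow, mul_one, ← hcard]
  ring

lemma sum_prod_pow_eq_factorial_mul_cycleIndex {α : Type*} [Fintype α] [DecidableEq α] {n : ℕ}
    (hn : Fintype.card α = n) (w : ℕ → ℝ) :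
    ∑ σ : Equiv.Perm α, ∏ j ∈ Finset.Icc 1 n, w j ^ σ.partition.parts.count j =
      n.factorial * cycleIndex w n := by
  subst hn
  rw [cycleIndex, Finset.mul_sum,
    ← Finset.sum_fiberwise Finset.univ fun σ : Equiv.Perm α => σ.partition]
  refine Finset.sum_congr rfl fun p _ => ?_
  have hsub : p.parts.toFinset ⊆ Finset.Icc 1 (Fintype.card α) := fun j hj => by
    rw [Multiset.mem_toFinset] at hj
    exact Finset.mem_Icc.2 ⟨p.parts_pos hj, p.le_of_mem_parts hj⟩
  have hprod : ∏ j ∈ Finset.Icc 1 (Fintype.card α), w j ^ p.parts.count j =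
      ∏ j ∈ p.parts.toFinset, w j ^ p.parts.count j := by
    refine (Finset.prod_subset hsub fun j _ hj => ?_).symm
    rw [Multiset.mem_toFinset] at hj
    rw [Multiset.count_eq_zero_of_notMem hj, pow_zero]
  have hconst : ∀ σ ∈ Finset.univ.filter fun σ : Equiv.Perm α => σ.partition = p,
      ∏ j ∈ Finset.Icc 1 (Fintype.card α), w j ^ σ.partition.parts.count j =
        ∏ j ∈ p.parts.toFinset, w j ^ p.parts.count j := fun σ hσ => by
    rw [(Finset.mem_filter.1 hσ).2, hprod]
  rw [Finset.sum_congr rfl hconst, Finset.sum_const, nsmul_eq_mul, ← card_partition_eq_mul p,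
    typeWeight, Finset.prod_multiset_count]
  push_cast
  rw [mul_assoc, ← Finset.prod_mul_distrib, ← Finset.prod_mul_distrib]
  congr 1
  refine Finset.prod_congr rfl fun j hj => ?_
  have hj : 0 < j := p.parts_pos (Multiset.mem_toFinset.1 hj)
  rw [div_pow]
  field_simp

lemma normConst_eq_cycleIndex (θ κ : ℕ → ℝ) (N : ℕ) :
    normConst θ κ N = cycleIndex (fun j => θ j + N * κ j) N := by
  have hsum : ∑ σ : Equiv.Perm (Fin N), cycleWeight θ κ N σ =
      N.factorial * cycleIndex (fun j => θ j + N * κ j) N :=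
    sum_prod_pow_eq_factorial_mul_cycleIndex (Fintype.card_fin N) fun j => θ j + N * κ j
  rw [normConst, hsum]
  field_simp

/-! ### Growth of the normalization -/

lemma factorial_le_exp_mul (n : ℕ) :
    ((n + 1).factorial : ℝ) ≤ Real.exp 1 * √(n + 1) * ((n + 1) / Real.exp 1) ^ (n + 1) := by
  have h : Stirling.stirlingSeq (n + 1) ≤ Stirling.stirlingSeq 1 :=
    Stirling.stirlingSeq'_antitone (Nat.zero_le n)
  rw [Stirling.stirlingSeq_one, Stirling.stirlingSeq, div_le_iff₀ (by positivity)] at h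
  push_cast at h
  rw [Real.sqrt_mul zero_le_two] at h
  calc ((n + 1).factorial : ℝ) ≤ _ := h
    _ = _ := by field_simp

lemma exp_sub_two_div_le_pow_floor_div_factorial {y : ℝ} (hy : 0 ≤ y) :
    Real.exp (y - 2) / (y + 1) ≤ y ^ ⌊y⌋₊ / ⌊y⌋₊.factorial := by
  rcases h : ⌊y⌋₊ with _ | n
  · have hy1 : y < 1 := Nat.floor_eq_zero.1 h
    rw [pow_zero, Nat.factorial_zero, Nat.cast_one, div_one]
    exact div_le_one_of_le₀ ((Real.exp_le_one_iff.2 (by linarith)).trans (by linarith))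
      (by linarith)
  · have hle : (n : ℝ) + 1 ≤ y := by exact_mod_cast h ▸ Nat.floor_le hy
    have hlt : y < n + 1 + 1 := by exact_mod_cast h ▸ Nat.lt_floor_add_one y
    have hsqrt : √((n : ℝ) + 1) ≤ y + 1 :=
      Real.sqrt_le_iff.2 ⟨by linarith, by nlinarith⟩
    rw [div_le_div_iff₀ (by linarith) (by positivity)]
    calc Real.exp (y - 2) * ((n + 1).factorial : ℝ)
        ≤ Real.exp n * (Real.exp 1 * √(n + 1) * ((n + 1) / Real.exp 1) ^ (n + 1)) := by
          gcongr
          · linarith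
          · exact factorial_le_exp_mul n
      _ = √(n + 1) * ((n : ℝ) + 1) ^ (n + 1) := by
          rw [div_pow, ← Real.exp_nat_mul, mul_one, Nat.cast_succ, Real.exp_add]
          field_simp
      _ ≤ (y + 1) * y ^ (n + 1) := by gcongr
      _ = y ^ (n + 1) * (y + 1) := mul_comm _ _

lemma exists_multiset_sum_eq_of_nonArithmetic {κ : ℕ → ℝ} (hκ : ∀ j, 1 ≤ j → 0 ≤ κ j)
    (hna : NonArithmetic κ) :
    ∃ K : ℕ, ∀ s ≥ K, ∃ p : Multiset ℕ, (∀ j ∈ p, 1 ≤ j ∧ 0 < κ j) ∧ p.sum = s := by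
  let S : Set ℕ := {j | 1 ≤ j ∧ 0 < κ j}
  have hmem {j : ℕ} (hj : 1 ≤ j) (h0 : κ j ≠ 0) : j ∈ S := ⟨hj, (hκ j hj).lt_of_ne' h0⟩
  have hgcd : Nat.setGcd S = 1 := by
    by_contra h
    rcases Nat.eq_zero_or_pos (Nat.setGcd S) with h0 | h0
    · refine hna ⟨2, one_lt_two, fun j hj hκj => ?_⟩
      have hdvd := Nat.setGcd_dvd_of_mem (hmem hj hκj)
      rw [h0, zero_dvd_iff] at hdvd
      omega
    · exact hna ⟨Nat.setGcd S, by omega, fun j hj hκj => Nat.setGcd_dvd_of_mem (hmem hj hκj)⟩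
  obtain ⟨K, hK⟩ := Nat.exists_mem_closure_of_ge S
  exact ⟨K, fun s hs => AddSubmonoid.exists_multiset_of_mem_closure
    (hK s hs (hgcd ▸ one_dvd s))⟩

lemma eventually_normConst_pos {θ κ : ℕ → ℝ} (hθ : ∀ j, 1 ≤ j → 0 ≤ θ j)
    (hκ : ∀ j, 1 ≤ j → 0 ≤ κ j) (hna : NonArithmetic κ) :
    ∀ᶠ N : ℕ in atTop, 0 < normConst θ κ N := by
  obtain ⟨K, hK⟩ := exists_multiset_sum_eq_of_nonArithmetic hκ hna
  filter_upwards [eventually_ge_atTop K, eventually_gt_atTop 0] with N hN hN0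
  obtain ⟨p, hp, rfl⟩ := hK N hN
  have hw (j : ℕ) (hj : 1 ≤ j) : 0 ≤ θ j + p.sum * κ j :=
    add_nonneg (hθ j hj) (mul_nonneg (Nat.cast_nonneg _) (hκ j hj))
  rw [normConst_eq_cycleIndex]
  refine (typeWeight_pos fun j hj => ⟨(hp j hj).1, ?_⟩).trans_le
    (typeWeight_le_cycleIndex hw fun j hj => (hp j hj).1)
  exact add_pos_of_nonneg_of_pos (hθ j (hp j hj).1)
    (mul_pos (Nat.cast_pos.2 hN0) (hp j hj).2)

/-- The cycle type with `⌊t κ_j / j⌋` cycles of each length `j ≤ J`. These are the most likely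
multiplicities when the numbers of cycles of length `j` are Poisson with mean `t κ_j / j`. -/
def modalType (κ : ℕ → ℝ) (J t : ℕ) : Multiset ℕ :=
  ∑ j ∈ Finset.Icc 1 J, Multiset.replicate ⌊t * κ j / j⌋₊ j

lemma count_modalType (κ : ℕ → ℝ) (t : ℕ) {J j : ℕ} (hj : j ∈ Finset.Icc 1 J) :
    (modalType κ J t).count j = ⌊t * κ j / j⌋₊ := by
  simp only [modalType, Multiset.count_sum', Multiset.count_replicate]
  rw [Finset.sum_ite_eq', if_pos hj]

lemma toFinset_modalType_subset (κ : ℕ → ℝ) (J t : ℕ) :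
    (modalType κ J t).toFinset ⊆ Finset.Icc 1 J := by
  intro j hj
  rw [Multiset.mem_toFinset, modalType, Multiset.mem_sum] at hj
  obtain ⟨i, hi, hij⟩ := hj
  rwa [Multiset.eq_of_mem_replicate hij]

lemma sum_modalType (κ : ℕ → ℝ) (J t : ℕ) :
    (modalType κ J t).sum = ∑ j ∈ Finset.Icc 1 J, ⌊t * κ j / j⌋₊ * j := by
  simp only [modalType, Multiset.sum_sum, Multiset.sum_replicate, smul_eq_mul]

section ModalType

variable {κ : ℕ → ℝ} (hκ : ∀ j, 1 ≤ j → 0 ≤ κ j) {J : ℕ}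
  (hsum : ∑ j ∈ Finset.Icc 1 J, κ j = 1) (t : ℕ)
include hsum

lemma le_sum_modalType_add_sq : t ≤ (modalType κ J t).sum + J ^ 2 := by
  have h : ∑ j ∈ Finset.Icc 1 J, (t * κ j - J) ≤ ((modalType κ J t).sum : ℝ) := by
    rw [sum_modalType, Nat.cast_sum]
    refine Finset.sum_le_sum fun j hj => ?_
    obtain ⟨hj1, hjJ⟩ := Finset.mem_Icc.1 hj
    have hfloor := Nat.sub_one_lt_floor (t * κ j / j)
    have hjJ : (j : ℝ) ≤ J := by exact_mod_cast hjJ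
    have hj0 : (0 : ℝ) < j := by positivity
    rw [div_sub_one hj0.ne', div_lt_iff₀ hj0] at hfloor
    push_cast
    linarith
  rw [Finset.sum_sub_distrib, ← Finset.mul_sum, hsum, Finset.sum_const, Nat.card_Icc,
    nsmul_eq_mul, Nat.add_sub_cancel] at h
  have h' : (t : ℝ) ≤ (modalType κ J t).sum + (J : ℝ) ^ 2 := by linarith
  exact_mod_cast h'

include hκ

lemma sum_modalType_le : (modalType κ J t).sum ≤ t := by
  have h : ((modalType κ J t).sum : ℝ) ≤ ∑ j ∈ Finset.Icc 1 J, t * κ j := by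
    rw [sum_modalType, Nat.cast_sum]
    refine Finset.sum_le_sum fun j hj => ?_
    obtain ⟨hj1, -⟩ := Finset.mem_Icc.1 hj
    rw [Nat.cast_mul, ← le_div_iff₀ (by positivity)]
    exact Nat.floor_le (div_nonneg (mul_nonneg t.cast_nonneg (hκ j hj1)) j.cast_nonneg)
  rw [← Finset.mul_sum, hsum, mul_one] at h
  exact_mod_cast h

lemma exp_div_le_typeWeight_modalType :
    Real.exp (t * ∑ j ∈ Finset.Icc 1 J, κ j / j - 2 * J) / (t + 1) ^ J ≤
      typeWeight (fun j => t * κ j) (modalType κ J t) := by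
  have hexp : Real.exp (t * ∑ j ∈ Finset.Icc 1 J, κ j / j - 2 * J) / (t + 1) ^ J =
      ∏ j ∈ Finset.Icc 1 J, Real.exp (t * κ j / j - 2) / (t + 1) := by
    rw [Finset.prod_div_distrib, ← Real.exp_sum, Finset.prod_const, Finset.sum_sub_distrib,
      Finset.sum_const, Nat.card_Icc, Nat.add_sub_cancel, nsmul_eq_mul, Finset.mul_sum,
      mul_comm (J : ℝ)]
    simp only [mul_div_assoc]
  rw [hexp, typeWeight_eq_prod _ (toFinset_modalType_subset κ J t)]
  refine Finset.prod_le_prod (fun j _ => by positivity) fun j hj => ?_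
  obtain ⟨hj1, -⟩ := Finset.mem_Icc.1 hj
  have hκj := hκ j hj1
  have hκj1 : κ j ≤ 1 := hsum ▸ Finset.single_le_sum (f := κ)
    (fun i hi => hκ i (Finset.mem_Icc.1 hi).1) hj
  have hle : t * κ j / j ≤ t := by
    have hj1 : (1 : ℝ) ≤ j := by exact_mod_cast hj1
    exact (div_le_self (by positivity) hj1).trans (mul_le_of_le_one_right t.cast_nonneg hκj1)
  rw [count_modalType κ t hj]
  refine le_trans ?_ (exp_sub_two_div_le_pow_floor_div_factorial (y := t * κ j / j)
    (by positivity))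
  gcongr

end ModalType

lemma exists_pos_le_typeWeight {κ : ℕ → ℝ} (hκ : ∀ j, 1 ≤ j → 0 ≤ κ j) (hna : NonArithmetic κ)
    (d : ℕ) :
    ∃ K : ℕ, 1 ≤ K ∧ ∃ δ > 0, ∀ s, K ≤ s → s ≤ K + d → ∃ p : Multiset ℕ,
      (∀ j ∈ p, 1 ≤ j) ∧ p.sum = s ∧ δ ≤ typeWeight κ p := by
  obtain ⟨K, hK⟩ := exists_multiset_sum_eq_of_nonArithmetic hκ hna
  choose! p hp hps using hK
  obtain ⟨s, hs, hmin⟩ := (Finset.Icc (K + 1) (K + 1 + d)).exists_min_image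
    (fun s => typeWeight κ (p s)) ⟨K + 1, by simp⟩
  refine ⟨K + 1, Nat.succ_pos K, typeWeight κ (p s), ?_, fun s' hs' hsd => ?_⟩
  · exact typeWeight_pos (hp s (by have := (Finset.mem_Icc.1 hs).1; omega))
  · exact ⟨p s', fun j hj => (hp s' (by omega) j hj).1, hps s' (by omega),
      hmin s' (Finset.mem_Icc.2 ⟨hs', hsd⟩)⟩

/-- The modal cycle type for `N - K` falls short of `N` by at least `K` and by at most `K + J²`; it
is completed by one of finitely many cycle types supported on the lengths with `κ_j > 0`. -/
lemma exists_eventually_exp_div_le_normConst {θ κ : ℕ → ℝ} (hθ : ∀ j, 1 ≤ j → 0 ≤ θ j)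
    (hκ : ∀ j, 1 ≤ j → 0 ≤ κ j) (hna : NonArithmetic κ) {J : ℕ}
    (hsum : ∑ j ∈ Finset.Icc 1 J, κ j = 1) :
    ∃ c > 0, ∀ᶠ N : ℕ in atTop,
      c * Real.exp (N * ∑ j ∈ Finset.Icc 1 J, κ j / j) / (N + 1) ^ J ≤ normConst θ κ N := by
  obtain ⟨K, hK1, δ, hδ, hcomplete⟩ := exists_pos_le_typeWeight hκ hna (J ^ 2)
  set G := ∑ j ∈ Finset.Icc 1 J, κ j / j
  refine ⟨δ * Real.exp (-(K * G + 2 * J)), by positivity, ?_⟩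
  filter_upwards [eventually_ge_atTop K] with N hN
  obtain ⟨t, rfl⟩ := Nat.exists_eq_add_of_le' hN
  have hle := sum_modalType_le hκ hsum t
  have hge := le_sum_modalType_add_sq hsum t
  obtain ⟨p, hp1, hps, hpδ⟩ := hcomplete (t + K - (modalType κ J t).sum) (by omega) (by omega)
  have htκ (j : ℕ) (hj : 1 ≤ j) : 0 ≤ t * κ j := mul_nonneg t.cast_nonneg (hκ j hj)
  have hweight (j : ℕ) (hj : 1 ≤ j) : t * κ j + κ j ≤ θ j + (t + K : ℕ) * κ j := by
    have hK1 : (1 : ℝ) ≤ K := by exact_mod_cast hK1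
    push_cast
    nlinarith [hθ j hj, hκ j hj]
  have hmodal1 : ∀ j ∈ modalType κ J t, 1 ≤ j := fun j hj =>
    (Finset.mem_Icc.1 (toFinset_modalType_subset κ J t (Multiset.mem_toFinset.2 hj))).1
  calc δ * Real.exp (-(K * G + 2 * J)) * Real.exp ((t + K : ℕ) * G) / ((t + K : ℕ) + 1) ^ J
      = δ * Real.exp (t * G - 2 * J) / ((t + K : ℕ) + 1) ^ J := by
        rw [mul_assoc, ← Real.exp_add]
        push_cast
        ring_nf
    _ ≤ δ * Real.exp (t * G - 2 * J) / (t + 1) ^ J := by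
        gcongr
        omega
    _ = Real.exp (t * G - 2 * J) / (t + 1) ^ J * δ := by ring
    _ ≤ typeWeight (fun j => t * κ j) (modalType κ J t) * typeWeight κ p :=
        mul_le_mul (exp_div_le_typeWeight_modalType hκ hsum t) hpδ hδ.le (typeWeight_nonneg htκ _)
    _ ≤ typeWeight ((fun j => t * κ j) + κ) (modalType κ J t + p) :=
        typeWeight_mul_typeWeight_le htκ hκ _ _
    _ ≤ typeWeight (fun j => θ j + (t + K : ℕ) * κ j) (modalType κ J t + p) :=
        typeWeight_mono (fun j hj => add_nonneg (htκ j hj) (hκ j hj)) hweight _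
    _ ≤ cycleIndex (fun j => θ j + (t + K : ℕ) * κ j) (modalType κ J t + p).sum :=
        typeWeight_le_cycleIndex
          (fun j hj => (add_nonneg (htκ j hj) (hκ j hj)).trans (hweight j hj))
          fun j hj => (Multiset.mem_add.1 hj).elim (hmodal1 j) (hp1 j)
    _ = normConst θ κ (t + K) := by
        rw [Multiset.sum_add, hps, Nat.add_sub_cancel' (by omega), normConst_eq_cycleIndex]

/-! ### The generating functions and the radius `r_*` -/

/-- The sum `g_a(x) = ∑_{j ≥ 1} (a_j / j) x^j` at a real point, where it equals the complex
`genFun`. -/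
def genSum (a : ℕ → ℝ) (x : ℝ) : ℝ := ∑' j : ℕ, genCoeff a j * x ^ j

/-- The `j`-th term `a_j x^j` of the series `g_a^{\{1\}}(x)`.  At `x = r_*` and `a = κ` it is the
asymptotic probability that a given element lies in a cycle of length `j`.  The term at `j = 0`
vanishes whatever the value of `a 0`. -/
def limitWeight (a : ℕ → ℝ) (x : ℝ) (j : ℕ) : ℝ := j * (genCoeff a j * x ^ j)

section GenSum

variable {a : ℕ → ℝ} {x y : ℝ}

lemma genCoeff_nonneg (ha : ∀ j, 1 ≤ j → 0 ≤ a j) (j : ℕ) : 0 ≤ genCoeff a j := by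
  unfold genCoeff
  split_ifs with hj
  · exact le_rfl
  · exact div_nonneg (ha j (Nat.one_le_iff_ne_zero.2 hj)) j.cast_nonneg

lemma natCast_mul_genCoeff {j : ℕ} (hj : j ≠ 0) : j * genCoeff a j = a j := by
  rw [genCoeff, if_neg hj, mul_div_cancel₀ _ (Nat.cast_ne_zero.2 hj)]

lemma limitWeight_zero_right : limitWeight a x 0 = 0 := by simp [limitWeight]

lemma limitWeight_of_ne_zero {j : ℕ} (hj : j ≠ 0) : limitWeight a x j = a j * x ^ j := by
  rw [limitWeight, ← mul_assoc, natCast_mul_genCoeff hj]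

lemma limitWeight_zero_left (j : ℕ) : limitWeight a 0 j = 0 := by
  rcases eq_or_ne j 0 with rfl | hj
  · exact limitWeight_zero_right
  · simp [limitWeight, hj]

lemma limitWeight_nonneg (ha : ∀ j, 1 ≤ j → 0 ≤ a j) (hx : 0 ≤ x) (j : ℕ) :
    0 ≤ limitWeight a x j :=
  mul_nonneg j.cast_nonneg (mul_nonneg (genCoeff_nonneg ha j) (pow_nonneg hx j))

lemma limitWeight_mono (ha : ∀ j, 1 ≤ j → 0 ≤ a j) (hx : 0 ≤ x) (hxy : x ≤ y) (j : ℕ) :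
    limitWeight a x j ≤ limitWeight a y j := by
  have := genCoeff_nonneg ha j
  unfold limitWeight
  gcongr

lemma genCoeff_mul_pow_le_limitWeight (ha : ∀ j, 1 ≤ j → 0 ≤ a j) (hx : 0 ≤ x) (j : ℕ) :
    genCoeff a j * x ^ j ≤ limitWeight a x j := by
  rcases Nat.eq_zero_or_pos j with rfl | hj
  · simp [limitWeight, genCoeff]
  · exact le_mul_of_one_le_left (mul_nonneg (genCoeff_nonneg ha j) (pow_nonneg hx j))
      (by exact_mod_cast hj)

lemma sum_range_limitWeight (J : ℕ) :
    ∑ j ∈ Finset.range (J + 1), limitWeight a x j = ∑ j ∈ Finset.Icc 1 J, a j * x ^ j := by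
  rw [Finset.sum_range_eq_add_Ico _ J.succ_pos, limitWeight_zero_right, zero_add]
  exact Finset.sum_congr rfl fun j hj =>
    limitWeight_of_ne_zero (Nat.one_le_iff_ne_zero.1 (Finset.mem_Icc.1 hj).1)

lemma modDeriv_one_ofReal (hx : 0 ≤ x) :
    modDeriv a 1 (ENNReal.ofReal x) = ∑' j, ENNReal.ofReal (limitWeight a x j) := by
  refine tsum_congr fun j => ?_
  rw [limitWeight, Nat.descFactorial_one, ← ENNReal.ofReal_pow hx, ← ENNReal.ofReal_natCast,
    mul_assoc, ← ENNReal.ofReal_mul' (by positivity), ← ENNReal.ofReal_mul j.cast_nonneg]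

lemma modDeriv_one_le_one_iff (ha : ∀ j, 1 ≤ j → 0 ≤ a j) (hx : 0 ≤ x) :
    modDeriv a 1 (ENNReal.ofReal x) ≤ 1 ↔ ∀ J, ∑ j ∈ Finset.Icc 1 J, a j * x ^ j ≤ 1 := by
  rw [modDeriv_one_ofReal hx, ENNReal.tsum_eq_iSup_nat' (tendsto_add_atTop_nat 1), iSup_le_iff]
  refine forall_congr' fun J => ?_
  rw [← ENNReal.ofReal_sum_of_nonneg fun j _ => limitWeight_nonneg ha hx j, ENNReal.ofReal_le_one,
    sum_range_limitWeight]

lemma hasSum_limitWeight (ha : ∀ j, 1 ≤ j → 0 ≤ a j) (hx : 0 ≤ x)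
    (h : modDeriv a 1 (ENNReal.ofReal x) ≠ ∞) :
    HasSum (limitWeight a x) (modDeriv a 1 (ENNReal.ofReal x)).toReal := by
  rw [modDeriv_one_ofReal hx] at h ⊢
  have hsum := ENNReal.hasSum_toReal h
  rw [← ENNReal.tsum_toReal_eq (ENNReal.ne_top_of_tsum_ne_top h)] at hsum
  simpa only [ENNReal.toReal_ofReal (limitWeight_nonneg ha hx _)] using hsum

lemma modDeriv_one_eq_ofReal_tsum (ha : ∀ j, 1 ≤ j → 0 ≤ a j) (hx : 0 ≤ x)
    (h : Summable (limitWeight a x)) :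
    modDeriv a 1 (ENNReal.ofReal x) = ENNReal.ofReal (∑' j, limitWeight a x j) := by
  rw [modDeriv_one_ofReal hx, ENNReal.ofReal_tsum_of_nonneg (limitWeight_nonneg ha hx) h]

lemma ofReal_div_mul_modDeriv_one_le (ha : ∀ j, 1 ≤ j → 0 ≤ a j) (hx : 0 < x) (hxy : x ≤ y) :
    ENNReal.ofReal (y / x) * modDeriv a 1 (ENNReal.ofReal x) ≤ modDeriv a 1 (ENNReal.ofReal y) := by
  have hy : 0 < y := hx.trans_le hxy
  rw [modDeriv_one_ofReal hx.le, modDeriv_one_ofReal hy.le, ← ENNReal.tsum_mul_left]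
  refine ENNReal.tsum_le_tsum fun j => ?_
  rw [← ENNReal.ofReal_mul (by positivity)]
  refine ENNReal.ofReal_le_ofReal ?_
  rcases j with _ | j
  · simp only [limitWeight_zero_right, mul_zero, le_rfl]
  · have := genCoeff_nonneg ha (j + 1)
    calc y / x * limitWeight a x (j + 1)
        = ((j + 1 : ℕ) : ℝ) * (genCoeff a (j + 1) * (x ^ j * y)) := by
          rw [limitWeight]; field_simp; ring
      _ ≤ ((j + 1 : ℕ) : ℝ) * (genCoeff a (j + 1) * (y ^ j * y)) := by gcongr
      _ = limitWeight a y (j + 1) := by rw [limitWeight, pow_succ]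

lemma one_lt_modDeriv_one_of_lt (ha : ∀ j, 1 ≤ j → 0 ≤ a j) (hx : 0 < x) (hxy : x < y)
    (h : 1 ≤ modDeriv a 1 (ENNReal.ofReal x)) : 1 < modDeriv a 1 (ENNReal.ofReal y) :=
  calc 1 < ENNReal.ofReal (y / x) := ENNReal.one_lt_ofReal.2 ((one_lt_div hx).2 hxy)
    _ ≤ ENNReal.ofReal (y / x) * modDeriv a 1 (ENNReal.ofReal x) := le_mul_of_one_le_right' h
    _ ≤ _ := ofReal_div_mul_modDeriv_one_le ha hx hxy.le

lemma exists_one_lt_modDeriv_one (hpos : ∃ j, 1 ≤ j ∧ 0 < a j) :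
    ∃ x > 0, 1 < modDeriv a 1 (ENNReal.ofReal x) := by
  obtain ⟨j, hj, haj⟩ := hpos
  have hx : 1 ≤ 1 + 1 / a j := by simp [haj.le]
  refine ⟨1 + 1 / a j, by positivity, ?_⟩
  rw [modDeriv_one_ofReal (by positivity)]
  refine lt_of_lt_of_le ?_ (ENNReal.le_tsum j)
  rw [ENNReal.one_lt_ofReal, limitWeight_of_ne_zero (Nat.one_le_iff_ne_zero.1 hj)]
  calc 1 < a j * (1 + 1 / a j) := by rw [mul_add, mul_one_div_cancel haj.ne']; linarith
    _ ≤ a j * (1 + 1 / a j) ^ j := by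
      gcongr
      exact le_self_pow₀ hx (by omega)

lemma norm_ofScalars_genCoeff (ha : ∀ j, 1 ≤ j → 0 ≤ a j) (j : ℕ) :
    ‖FormalMultilinearSeries.ofScalars ℂ (fun j => ((genCoeff a j : ℝ) : ℂ)) j‖ =
      genCoeff a j := by
  rw [FormalMultilinearSeries.ofScalars_norm, Complex.norm_real,
    Real.norm_of_nonneg (genCoeff_nonneg ha j)]

lemma summable_genCoeff_mul_pow (ha : ∀ j, 1 ≤ j → 0 ≤ a j) (hx : 0 ≤ x)
    (hxR : ENNReal.ofReal x < genRadius a) : Summable fun j => genCoeff a j * x ^ j := by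
  simpa only [norm_ofScalars_genCoeff ha, Real.coe_toNNReal x hx] using
    FormalMultilinearSeries.summable_norm_mul_pow _ hxR

lemma summable_limitWeight (ha : ∀ j, 1 ≤ j → 0 ≤ a j) (hx : 0 ≤ x)
    (hxR : ENNReal.ofReal x < genRadius a) : Summable (limitWeight a x) := by
  obtain ⟨q, hq, C, -, hbound⟩ :=
    FormalMultilinearSeries.norm_mul_pow_le_mul_pow_of_lt_radius _ hxR
  have hgeom : Summable fun j : ℕ => C * ((j : ℝ) ^ 1 * q ^ j) :=
    (summable_pow_mul_geometric_of_norm_lt_one 1 (by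
      rw [Real.norm_of_nonneg hq.1.le]; exact hq.2)).mul_left C
  refine Summable.of_nonneg_of_le (limitWeight_nonneg ha hx) (fun j => ?_) hgeom
  have hj := hbound j
  rw [norm_ofScalars_genCoeff ha, Real.coe_toNNReal x hx] at hj
  calc limitWeight a x j ≤ j * (C * q ^ j) := mul_le_mul_of_nonneg_left hj j.cast_nonneg
    _ = C * ((j : ℝ) ^ 1 * q ^ j) := by ring

lemma ofReal_le_genRadius (ha : ∀ j, 1 ≤ j → 0 ≤ a j) (hx : 0 ≤ x)
    (h : modDeriv a 1 (ENNReal.ofReal x) ≠ ∞) : ENNReal.ofReal x ≤ genRadius a := by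
  refine FormalMultilinearSeries.le_radius_of_summable_norm _ ?_
  simp only [norm_ofScalars_genCoeff ha, Real.coe_toNNReal x hx]
  exact (hasSum_limitWeight ha hx h).summable.of_nonneg_of_le
    (fun j => mul_nonneg (genCoeff_nonneg ha j) (pow_nonneg hx j))
    (genCoeff_mul_pow_le_limitWeight ha hx)

lemma continuousOn_tsum_limitWeight (ha : ∀ j, 1 ≤ j → 0 ≤ a j)
    (hsum : Summable (limitWeight a x)) :
    ContinuousOn (fun y => ∑' j, limitWeight a y j) (Set.Icc 0 x) := by
  refine continuousOn_tsum (fun j => ?_) hsum fun j y hy => ?_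
  · unfold limitWeight
    fun_prop
  · rw [Real.norm_of_nonneg (limitWeight_nonneg ha hy.1 j)]
    exact limitWeight_mono ha hy.1 hy.2 j

lemma exists_modDeriv_one_eq_one (ha : ∀ j, 1 ≤ j → 0 ≤ a j) (hx : 0 ≤ x)
    (hxR : ENNReal.ofReal x < genRadius a) (h : 1 ≤ modDeriv a 1 (ENNReal.ofReal x)) :
    ∃ r, 0 < r ∧ r ≤ x ∧ modDeriv a 1 (ENNReal.ofReal r) = 1 := by
  have hsum := summable_limitWeight ha hx hxR
  have htsum_zero : ∑' j, limitWeight a 0 j = 0 := by simp only [limitWeight_zero_left, tsum_zero]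
  rw [modDeriv_one_eq_ofReal_tsum ha hx hsum, ENNReal.one_le_ofReal] at h
  obtain ⟨r, hr, hr1 : ∑' j, limitWeight a r j = 1⟩ :=
    intermediate_value_Icc hx (continuousOn_tsum_limitWeight ha hsum)
      ⟨htsum_zero.trans_le zero_le_one, h⟩
  have hr0 : r ≠ 0 := by
    rintro rfl
    exact zero_ne_one (htsum_zero.symm.trans hr1)
  have hsum_r := hsum.of_nonneg_of_le (limitWeight_nonneg ha hr.1) (limitWeight_mono ha hr.1 hr.2)
  exact ⟨r, hr.1.lt_of_ne' hr0, hr.2, by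
    rw [modDeriv_one_eq_ofReal_tsum ha hr.1 hsum_r, hr1, ENNReal.ofReal_one]⟩

lemma modDeriv_mono (a : ℕ → ℝ) (n : ℕ) : Monotone (modDeriv a n) :=
  fun _ _ h => ENNReal.tsum_le_tsum fun j => by gcongr

lemma modDeriv_le_of_forall_lt {R c : ℝ≥0∞} (hR : 0 < R) {n : ℕ}
    (h : ∀ x < R, modDeriv a n x ≤ c) : modDeriv a n R ≤ c := by
  refine ENNReal.tsum_le_of_sum_range_le fun k => ?_
  have hcont : Continuous fun x : ℝ≥0∞ => ∑ j ∈ Finset.range k,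
      (j.descFactorial n : ℝ≥0∞) * ENNReal.ofReal (genCoeff a j) * x ^ j :=
    continuous_finsetSum _ fun j _ => (ENNReal.continuous_const_mul
      (ENNReal.mul_ne_top (ENNReal.natCast_ne_top _) ENNReal.ofReal_ne_top)).comp
        (ENNReal.continuous_pow j)
  have : (𝓝[<] R).NeBot := nhdsLT_neBot_of_exists_lt ⟨0, hR⟩
  refine le_of_tendsto (hcont.continuousAt.tendsto.mono_left
    (nhdsWithin_le_nhds (s := Set.Iio R))) ?_
  filter_upwards [self_mem_nhdsWithin] with x hx
  exact (ENNReal.sum_le_tsum _).trans (h x hx)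

end GenSum

section RStar

variable {κ : ℕ → ℝ} {r r' : ℝ}

lemma IsRStar.modDeriv_one_le_one (h : IsRStar κ r) : modDeriv κ 1 (ENNReal.ofReal r) ≤ 1 := by
  rcases le_or_gt 1 (modDeriv κ 1 (genRadius κ)) with hge | hlt
  · exact (h.2.2.1 hge).le
  · rw [h.2.2.2 hlt]
    exact hlt.le

lemma IsRStar.one_lt_modDeriv_one (hκ : ∀ j, 1 ≤ j → 0 ≤ κ j) (h : IsRStar κ r) {y : ℝ}
    (hy : r < y) : 1 < modDeriv κ 1 (ENNReal.ofReal y) := by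
  rcases le_or_gt 1 (modDeriv κ 1 (genRadius κ)) with hge | hlt
  · exact one_lt_modDeriv_one_of_lt hκ h.1 hy (h.2.2.1 hge).ge
  · by_contra! hle
    have hyR := ofReal_le_genRadius hκ (h.1.trans hy).le (hle.trans_lt ENNReal.one_lt_top).ne
    rw [← h.2.2.2 hlt, ENNReal.ofReal_le_ofReal_iff h.1.le] at hyR
    exact hy.not_ge hyR

lemma IsRStar.unique (hκ : ∀ j, 1 ≤ j → 0 ≤ κ j) (h : IsRStar κ r) (h' : IsRStar κ r') :
    r' = r := by
  by_contra hne
  rcases lt_or_gt_of_ne hne with hlt | hlt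
  · exact (h'.one_lt_modDeriv_one hκ hlt).not_ge h.modDeriv_one_le_one
  · exact (h.one_lt_modDeriv_one hκ hlt).not_ge h'.modDeriv_one_le_one

lemma exists_isRStar (hκ : ∀ j, 1 ≤ j → 0 ≤ κ j) (hpos : ∃ j, 1 ≤ j ∧ 0 < κ j)
    (hR : 0 < genRadius κ) : ∃ r, IsRStar κ r := by
  by_cases hex : ∃ x : ℝ, 0 ≤ x ∧ ENNReal.ofReal x < genRadius κ ∧
      1 < modDeriv κ 1 (ENNReal.ofReal x)
  · obtain ⟨x, hx, hxR, hx1⟩ := hex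
    obtain ⟨r, hr0, hrx, hr⟩ := exists_modDeriv_one_eq_one hκ hx hxR hx1.le
    have hrR : ENNReal.ofReal r ≤ genRadius κ := (ENNReal.ofReal_le_ofReal hrx).trans hxR.le
    exact ⟨r, hr0, hrR, fun _ => hr,
      fun hlt => absurd (hr.symm.trans_le (modDeriv_mono κ 1 hrR)) hlt.not_ge⟩
  · push Not at hex
    have hR_top : genRadius κ ≠ ∞ := fun htop => by
      obtain ⟨x, hx, hx1⟩ := exists_one_lt_modDeriv_one hpos
      exact (hex x hx.le (htop ▸ ENNReal.ofReal_lt_top)).not_gt hx1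
    have hle : modDeriv κ 1 (genRadius κ) ≤ 1 := modDeriv_le_of_forall_lt hR fun x hx => by
      have hx_eq := ENNReal.ofReal_toReal hx.ne_top
      rw [← hx_eq] at hx ⊢
      exact hex _ ENNReal.toReal_nonneg hx
    have hR_eq := ENNReal.ofReal_toReal hR_top
    refine ⟨(genRadius κ).toReal, ENNReal.toReal_pos hR.ne' hR_top, hR_eq.le, fun hge => ?_,
      fun _ => hR_eq⟩
    rw [hR_eq]
    exact hle.antisymm hge

lemma NonArithmetic.exists_pos (hκ : ∀ j, 1 ≤ j → 0 ≤ κ j) (hna : NonArithmetic κ) :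
    ∃ j, 1 ≤ j ∧ 0 < κ j := by
  by_contra! hnonpos
  exact hna ⟨2, one_lt_two, fun j hj hne => absurd ((hnonpos j hj).antisymm (hκ j hj)) hne⟩

lemma hasSum_pnat_of_hasSum_limitWeight {S : ℝ} (h : HasSum (limitWeight κ r) S) :
    HasSum (fun j : ℕ+ => κ j * r ^ (j : ℕ)) S := by
  refine ((PNat.coe_injective.hasSum_iff fun j hj => ?_).2 h).congr_fun fun j =>
    (limitWeight_of_ne_zero j.ne_zero).symm
  have hj0 : j = 0 := by
    by_contra hne
    exact hj ⟨⟨j, Nat.pos_of_ne_zero hne⟩, rfl⟩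
  rw [hj0, limitWeight_zero_right]

lemma AnalyticConditions.exists_ofReal_or_subcritical {θ κ : ℕ → ℝ}
    (h : AnalyticConditions θ κ) : Subcritical θ κ ∨
      ∃ R : ℝ, 0 < R ∧ genRadius κ = ENNReal.ofReal R ∧ ENNReal.ofReal R ≤ genRadius θ := by
  rcases h with h | ⟨R, _, _, _, _, _, _, hR, hκ, -, -, -, -, -, hθ, -⟩ |
    ⟨R, _, _, _, _, _, _, _, hR, hκ, -, -, -, -, -, -, -, hθ, -⟩ | ⟨R, hR, hκ, hθ, -⟩ |
    ⟨R, _, _, _, _, _, _, hR, hκ, -, -, -, -, -, hθ, -⟩ |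
    ⟨R, _, _, _, _, _, _, _, _, hR, hκ, -, -, -, -, -, -, -, -, hθ, -⟩
  · exact Or.inl h
  · exact Or.inr ⟨R, hR, hκ, hθ.1⟩
  · exact Or.inr ⟨R, hR, hκ, hθ.1⟩
  · exact Or.inr ⟨R, hR, hκ, hθ⟩
  · exact Or.inr ⟨R, hR, hκ, hθ.1⟩
  · exact Or.inr ⟨R, hR, hκ, hθ.1⟩

lemma AnalyticConditions.genRadius_pos_and_le {θ κ : ℕ → ℝ} (h : AnalyticConditions θ κ) :
    0 < genRadius κ ∧ genRadius κ ≤ genRadius θ := by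
  rcases h.exists_ofReal_or_subcritical with hsub | ⟨R, hR, hκ, hθ⟩
  · exact ⟨hsub.1, hsub.2.1⟩
  · exact ⟨hκ ▸ ENNReal.ofReal_pos.2 hR, hκ.trans_le hθ⟩

end RStar

/-- The standing hypotheses of the asymptotic analysis: `r` is the critical radius `r_*` of the
non-arithmetic sequence `κ`, and `g_θ` converges at least in the disk of radius `r`. -/
structure Admissible (θ κ : ℕ → ℝ) (r : ℝ) : Prop where
  θ_nonneg : ∀ j : ℕ, 1 ≤ j → 0 ≤ θ j
  κ_nonneg : ∀ j : ℕ, 1 ≤ j → 0 ≤ κ j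
  nonArithmetic : NonArithmetic κ
  isRStar : IsRStar κ r
  le_genRadius : ENNReal.ofReal r ≤ genRadius θ

namespace Admissible

variable {θ κ : ℕ → ℝ} {r : ℝ}

lemma pos (h : Admissible θ κ r) : 0 < r := h.isRStar.1

lemma hasSum_limitWeight (h : Admissible θ κ r) :
    HasSum (limitWeight κ r) (modDeriv κ 1 (ENNReal.ofReal r)).toReal :=
  SurrogateSpatial.hasSum_limitWeight h.κ_nonneg h.pos.le
    (h.isRStar.modDeriv_one_le_one.trans_lt ENNReal.one_lt_top).ne

lemma limitWeight_nonneg (h : Admissible θ κ r) (j : ℕ) : 0 ≤ limitWeight κ r j :=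
  SurrogateSpatial.limitWeight_nonneg h.κ_nonneg h.pos.le j

lemma limitWeight_le_one (h : Admissible θ κ r) (j : ℕ) : limitWeight κ r j ≤ 1 :=
  (le_hasSum h.hasSum_limitWeight j fun i _ => h.limitWeight_nonneg i).trans
    (ENNReal.toReal_le_of_le_ofReal zero_le_one
      (by simpa using h.isRStar.modDeriv_one_le_one))

lemma summable_genCoeff_mul_pow (h : Admissible θ κ r) :
    Summable fun j => genCoeff κ j * r ^ j :=
  h.hasSum_limitWeight.summable.of_nonneg_of_le
    (fun j => mul_nonneg (genCoeff_nonneg h.κ_nonneg j) (pow_nonneg h.pos.le j))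
    (genCoeff_mul_pow_le_limitWeight h.κ_nonneg h.pos.le)

end Admissible

/-! ### The exponential growth rate of the normalization -/

section GrowthRate

variable {θ κ : ℕ → ℝ} {r x G : ℝ}

lemma normConst_mul_pow (θ κ : ℕ → ℝ) (x : ℝ) (N : ℕ) :
    normConst (fun j => θ j * x ^ j) (fun j => κ j * x ^ j) N = normConst θ κ N * x ^ N := by
  rw [normConst_eq_cycleIndex, normConst_eq_cycleIndex, ← cycleIndex_mul_pow]
  simp only [add_mul, mul_assoc]

lemma NonArithmetic.mul_pow (hna : NonArithmetic κ) (hx : 0 < x) :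
    NonArithmetic fun j => κ j * x ^ j :=
  fun ⟨j₀, hj₀, hdvd⟩ => hna ⟨j₀, hj₀, fun j hj hne =>
    hdvd j hj (mul_ne_zero hne (pow_pos hx j).ne')⟩

-- Valid at `j = 0` too, where both sides vanish because `a 0 / 0 = 0`.
lemma mul_pow_div_natCast (a : ℕ → ℝ) (x : ℝ) (j : ℕ) :
    a j * x ^ j / j = genCoeff a j * x ^ j := by
  unfold genCoeff
  split_ifs with hj
  · simp [hj]
  · ring

lemma sum_Icc_mul_pow_div (a : ℕ → ℝ) (x : ℝ) (J : ℕ) :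
    ∑ j ∈ Finset.Icc 1 J, a j * x ^ j / j = ∑ j ∈ Finset.range (J + 1), genCoeff a j * x ^ j := by
  rw [Finset.sum_range_eq_add_Ico _ J.succ_pos, genCoeff, if_pos rfl, zero_mul, zero_add]
  exact Finset.sum_congr rfl fun j _ => mul_pow_div_natCast a x j

lemma exp_natCast_mul_sub_log (hx : 0 < x) (N : ℕ) (A : ℝ) :
    Real.exp (N * (A - Real.log x)) = Real.exp (N * A) / x ^ N := by
  rw [mul_sub, Real.exp_sub, ← Real.log_pow, Real.exp_log (pow_pos hx N)]

lemma exists_eventually_exp_div_le_normConst_of_sum_eq_one (hθ : ∀ j, 1 ≤ j → 0 ≤ θ j)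
    (hκ : ∀ j, 1 ≤ j → 0 ≤ κ j) (hna : NonArithmetic κ) (hx : 0 < x) {J : ℕ}
    (hsum : ∑ j ∈ Finset.Icc 1 J, κ j * x ^ j = 1) :
    ∃ c > 0, ∀ᶠ N : ℕ in atTop,
      c * Real.exp (N * (∑ j ∈ Finset.Icc 1 J, κ j * x ^ j / j - Real.log x)) / (N + 1) ^ J ≤
        normConst θ κ N := by
  obtain ⟨c, hc, hbound⟩ := exists_eventually_exp_div_le_normConst
    (fun j hj => mul_nonneg (hθ j hj) (pow_nonneg hx.le j))
    (fun j hj => mul_nonneg (hκ j hj) (pow_nonneg hx.le j)) (hna.mul_pow hx) hsum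
  refine ⟨c, hc, hbound.mono fun N hN => ?_⟩
  rw [normConst_mul_pow, ← div_le_iff₀ (pow_pos hx N)] at hN
  rw [exp_natCast_mul_sub_log hx]
  exact (le_of_eq (by ring)).trans hN

lemma eventually_exp_mul_le_mul_exp_div_pow {A B c : ℝ} (hAB : A < B) (hc : 0 < c) (J : ℕ) :
    ∀ᶠ N : ℕ in atTop, Real.exp (N * A) ≤ c * Real.exp (N * B) / (N + 1) ^ J := by
  have hlittle : (fun N : ℕ => ((N : ℝ) + 1) ^ J) =o[atTop]
      fun N : ℕ => Real.exp ((B - A) * ((N : ℝ) + 1)) :=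
    (isLittleO_pow_exp_pos_mul_atTop J (sub_pos.2 hAB)).comp_tendsto
      (tendsto_atTop_add_const_right atTop 1 tendsto_natCast_atTop_atTop)
  filter_upwards [hlittle.bound (c := c * Real.exp (A - B)) (by positivity)] with N hN
  rw [Real.norm_of_nonneg (by positivity), Real.norm_of_nonneg (by positivity), mul_assoc,
    ← Real.exp_add] at hN
  rw [le_div_iff₀ (by positivity)]
  calc Real.exp (N * A) * (N + 1) ^ J
      ≤ Real.exp (N * A) * (c * Real.exp (A - B + (B - A) * (N + 1))) := by gcongr
    _ = c * (Real.exp (N * A) * Real.exp (A - B + (B - A) * (N + 1))) := by ring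
    _ = c * Real.exp (N * B) := by rw [← Real.exp_add]; ring_nf

-- Partial sums of `g_κ^{\{1\}}` reach `1` slightly to the right of `r_*`, where the rate
-- `g_κ(x) - log x` is still close to its value at `r_*`.
lemma Admissible.exists_sum_eq_one_lt_rate (h : Admissible θ κ r)
    (hG : G < genSum κ r - Real.log r) :
    ∃ x > 0, ∃ J, ∑ j ∈ Finset.Icc 1 J, κ j * x ^ j = 1 ∧
      G < ∑ j ∈ Finset.Icc 1 J, κ j * x ^ j / j - Real.log x := by
  have hr := h.pos
  have hκ := h.κ_nonneg
  have hG_near : ∀ᶠ y in 𝓝[>] r, G < genSum κ r - Real.log y :=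
    ((continuousAt_const.sub (Real.continuousAt_log hr.ne')).eventually_const_lt hG).filter_mono
      nhdsWithin_le_nhds
  obtain ⟨y, hGy, hry : r < y⟩ := (hG_near.and self_mem_nhdsWithin).exists
  obtain ⟨J₁, hJ₁⟩ : ∃ J, 1 < ∑ j ∈ Finset.Icc 1 J, κ j * y ^ j := by
    by_contra! hle
    exact (h.isRStar.one_lt_modDeriv_one hκ hry).not_ge
      ((modDeriv_one_le_one_iff hκ (hr.trans hry).le).2 hle)
  have hpartial : Tendsto (fun J => ∑ j ∈ Finset.Icc 1 J, κ j * r ^ j / j) atTop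
      (𝓝 (genSum κ r)) := by
    simp only [sum_Icc_mul_pow_div]
    exact h.summable_genCoeff_mul_pow.hasSum.tendsto_sum_nat.comp (tendsto_add_atTop_nat 1)
  obtain ⟨J, hJ, hJ₁J⟩ := ((hpartial.eventually_const_lt (lt_sub_iff_add_lt.1 hGy)).and
    (eventually_ge_atTop J₁)).exists
  have hJy : 1 < ∑ j ∈ Finset.Icc 1 J, κ j * y ^ j :=
    hJ₁.trans_le (Finset.sum_le_sum_of_subset_of_nonneg (Finset.Icc_subset_Icc_right hJ₁J)
      fun j hj _ => mul_nonneg (hκ j (Finset.mem_Icc.1 hj).1) (pow_nonneg (hr.trans hry).le j))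
  obtain ⟨x, ⟨hrx, hxy⟩, hx1⟩ : ∃ x ∈ Set.Icc r y, ∑ j ∈ Finset.Icc 1 J, κ j * x ^ j = 1 :=
    intermediate_value_Icc hry.le (by fun_prop : Continuous _).continuousOn
      ⟨(modDeriv_one_le_one_iff hκ hr.le).1 h.isRStar.modDeriv_one_le_one J, hJy.le⟩
  refine ⟨x, hr.trans_le hrx, J, hx1, ?_⟩
  have hsum_le : ∑ j ∈ Finset.Icc 1 J, κ j * r ^ j / j ≤ ∑ j ∈ Finset.Icc 1 J, κ j * x ^ j / j :=
    Finset.sum_le_sum fun j hj => by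
      have := hκ j (Finset.mem_Icc.1 hj).1
      gcongr
  have hlog := Real.log_le_log (hr.trans_le hrx) hxy
  linarith

lemma Admissible.eventually_exp_le_normConst (h : Admissible θ κ r)
    (hG : G < genSum κ r - Real.log r) : ∀ᶠ N : ℕ in atTop, Real.exp (N * G) ≤ normConst θ κ N := by
  obtain ⟨x, hx, J, hsum, hlt⟩ := h.exists_sum_eq_one_lt_rate hG
  obtain ⟨c, hc, hbound⟩ := exists_eventually_exp_div_le_normConst_of_sum_eq_one h.θ_nonneg
    h.κ_nonneg h.nonArithmetic hx hsum
  filter_upwards [hbound, eventually_exp_mul_le_mul_exp_div_pow hlt hc J] with N hN hexp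
  exact hexp.trans hN

lemma normConst_mul_pow_le_exp (hθ : ∀ j, 1 ≤ j → 0 ≤ θ j) (hκ : ∀ j, 1 ≤ j → 0 ≤ κ j)
    (hx : 0 ≤ x) (hθx : Summable fun j => genCoeff θ j * x ^ j)
    (hκx : Summable fun j => genCoeff κ j * x ^ j) (N : ℕ) :
    normConst θ κ N * x ^ N ≤ Real.exp (genSum θ x + N * genSum κ x) := by
  have hsum_le {a : ℕ → ℝ} (ha : ∀ j, 1 ≤ j → 0 ≤ a j)
      (hax : Summable fun j => genCoeff a j * x ^ j) :
      ∑ j ∈ Finset.range (N + 1), genCoeff a j * x ^ j ≤ genSum a x :=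
    hax.sum_le_tsum _ fun j _ => mul_nonneg (genCoeff_nonneg ha j) (pow_nonneg hx j)
  rw [normConst_eq_cycleIndex, ← cycleIndex_mul_pow]
  refine (cycleIndex_le_exp (fun j hj => ?_) N).trans (Real.exp_le_exp.2 ?_)
  · have := hθ j hj
    have := hκ j hj
    positivity
  · calc ∑ j ∈ Finset.range (N + 1), (θ j + N * κ j) * x ^ j / j
        = ∑ j ∈ Finset.range (N + 1), genCoeff θ j * x ^ j +
            N * ∑ j ∈ Finset.range (N + 1), genCoeff κ j * x ^ j := by
          simp only [← mul_pow_div_natCast, Finset.mul_sum, ← Finset.sum_add_distrib]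
          exact Finset.sum_congr rfl fun j _ => by ring
      _ ≤ genSum θ x + N * genSum κ x := by gcongr <;> exact hsum_le ‹_› ‹_›

lemma genSum_mono {a : ℕ → ℝ} (ha : ∀ j, 1 ≤ j → 0 ≤ a j) (hx : 0 ≤ x) (hxr : x ≤ r)
    (hr : Summable fun j => genCoeff a j * r ^ j) :
    (Summable fun j => genCoeff a j * x ^ j) ∧ genSum a x ≤ genSum a r := by
  have hle (j : ℕ) : genCoeff a j * x ^ j ≤ genCoeff a j * r ^ j := by
    have := genCoeff_nonneg ha j
    gcongr
  have hsum := hr.of_nonneg_of_le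
    (fun j => mul_nonneg (genCoeff_nonneg ha j) (pow_nonneg hx j)) hle
  exact ⟨hsum, hsum.tsum_le_tsum hle hr⟩

lemma eventually_normConst_le_exp (hθ : ∀ j, 1 ≤ j → 0 ≤ θ j) (hκ : ∀ j, 1 ≤ j → 0 ≤ κ j)
    (hr : 0 < r) (hθr : ∀ x, 0 ≤ x → x < r → Summable fun j => genCoeff θ j * x ^ j)
    (hκr : Summable fun j => genCoeff κ j * r ^ j) (hG : genSum κ r - Real.log r < G) :
    ∀ᶠ N : ℕ in atTop, normConst θ κ N ≤ Real.exp (N * G) := by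
  have hG_near : ∀ᶠ x in 𝓝[<] r, genSum κ r - Real.log x < G :=
    ((continuousAt_const.sub (Real.continuousAt_log hr.ne')).eventually_lt_const hG).filter_mono
      nhdsWithin_le_nhds
  obtain ⟨x, hxG, hx, hxr⟩ := (hG_near.and (Ioo_mem_nhdsLT hr)).exists
  obtain ⟨hκx, hκ_le⟩ := genSum_mono hκ hx.le hxr.le hκr
  have hgrow : Tendsto (fun N : ℕ => (N : ℝ) * (G - (genSum κ r - Real.log x))) atTop atTop :=
    tendsto_natCast_atTop_atTop.atTop_mul_const (sub_pos.2 hxG)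
  filter_upwards [hgrow.eventually_ge_atTop (genSum θ x)] with N hN
  have hbound := normConst_mul_pow_le_exp hθ hκ hx.le (hθr x hx.le hxr) hκx N
  have hNκ : (N : ℝ) * genSum κ x ≤ N * genSum κ r := by gcongr
  rw [← le_div_iff₀ (pow_pos hx N), ← Real.exp_log (pow_pos hx N), ← Real.exp_sub,
    Real.log_pow] at hbound
  exact hbound.trans (Real.exp_le_exp.2 (by linarith))

end GrowthRate

/-! ### The length of the cycle through a point -/

section CycleLength

open Equiv.Perm

variable {N : ℕ} (σ τ : Equiv.Perm (Fin N)) (x : Fin N) (l : ℕ)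

open Classical in
/-- The length of the cycle of `σ` that contains `x`, which is `1` if `x` is a fixed point. -/
def cycleLength : ℕ := (Finset.univ.filter fun y => σ.SameCycle x y).card

lemma cycleLength_pos : 0 < cycleLength σ x :=
  Finset.card_pos.2 ⟨x, Finset.mem_filter.2 ⟨Finset.mem_univ x, SameCycle.refl σ x⟩⟩

variable {σ} {x} in
lemma cycleLength_eq_of_sameCycle {y : Fin N} (h : σ.SameCycle x y) :
    cycleLength σ x = cycleLength σ y := by
  unfold cycleLength
  congr 1
  ext z
  simp only [Finset.mem_filter, Finset.mem_univ, true_and]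
  exact ⟨h.symm.trans, h.trans⟩

lemma cycleLength_conj : cycleLength (τ * σ * τ⁻¹) (τ x) = cycleLength σ x := by
  classical
  refine (Finset.card_bij (fun y _ => τ y) (fun y hy => ?_) (fun a _ b _ h => τ.injective h)
    fun y hy => ⟨τ⁻¹ y, ?_, by simp⟩).symm
  · simpa [sameCycle_conj] using hy
  · simpa [sameCycle_conj] using hy

lemma cycleLength_of_apply_eq (hx : σ x = x) : cycleLength σ x = 1 := by
  classical
  refine Finset.card_eq_one.2 ⟨x, ?_⟩
  ext y
  simp only [Finset.mem_filter, Finset.mem_univ, true_and, Finset.mem_singleton]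
  exact ⟨fun hy => (hy.eq_of_left hx).symm, by rintro rfl; exact SameCycle.refl σ _⟩

lemma cycleLength_of_apply_ne (hx : σ x ≠ x) :
    cycleLength σ x = (σ.cycleOf x).support.card := by
  classical
  unfold cycleLength
  congr 1
  ext y
  rw [mem_support_cycleOf_iff]
  simp [hx]

lemma two_le_cycleLength (hx : σ x ≠ x) : 2 ≤ cycleLength σ x := by
  rw [cycleLength_of_apply_ne σ x hx]
  exact two_le_card_support_cycleOf_iff.2 hx

lemma card_cycleLength_eq_one :
    (Finset.univ.filter fun x => cycleLength σ x = 1).card = cycleCount σ 1 := by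
  have hfixed : (Finset.univ.filter fun x => cycleLength σ x = 1) = σ.supportᶜ := by
    ext x
    simp only [Finset.mem_filter, Finset.mem_univ, true_and, Finset.mem_compl, mem_support, not_not]
    exact ⟨fun h => by_contra fun hx => by have := two_le_cycleLength σ x hx; omega,
      cycleLength_of_apply_eq σ x⟩
  have hno_one : σ.cycleType.count 1 = 0 := Multiset.count_eq_zero_of_notMem fun h =>
    absurd (two_le_of_mem_cycleType h) (by norm_num)
  rw [hfixed, Finset.card_compl, Fintype.card_fin]
  simp [cycleCount, parts_partition, hno_one]

lemma filter_cycleLength_eq_biUnion (hl : 2 ≤ l) :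
    (Finset.univ.filter fun x => cycleLength σ x = l) =
      (σ.cycleFactorsFinset.filter fun c => c.support.card = l).biUnion fun c => c.support := by
  ext x
  simp only [Finset.mem_filter, Finset.mem_univ, true_and, Finset.mem_biUnion]
  constructor
  · intro h
    have hx : σ x ≠ x := fun hx => by
      rw [cycleLength_of_apply_eq σ x hx] at h
      omega
    refine ⟨σ.cycleOf x, ⟨?_, ?_⟩, ?_⟩
    · exact cycleOf_mem_cycleFactorsFinset_iff.2 (mem_support.2 hx)
    · rw [← h, cycleLength_of_apply_ne σ x hx]
    · exact mem_support_cycleOf_iff.2 ⟨SameCycle.refl σ x, mem_support.2 hx⟩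
  · rintro ⟨c, ⟨hc, rfl⟩, hx⟩
    rw [cycleLength_of_apply_ne σ x (mem_support.1 (mem_cycleFactorsFinset_support_le hc hx)),
      ← cycle_is_cycleOf hx hc]

lemma card_cycleLength_eq :
    (Finset.univ.filter fun x => cycleLength σ x = l).card = l * cycleCount σ l := by
  obtain rfl | rfl | hl : l = 0 ∨ l = 1 ∨ 2 ≤ l := by omega
  · simp [(cycleLength_pos σ _).ne']
  · rw [card_cycleLength_eq_one, one_mul]
  · have hcount : cycleCount σ l =
        (σ.cycleFactorsFinset.filter fun c => c.support.card = l).card := by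
      rw [cycleCount, parts_partition, Multiset.count_add, Multiset.count_replicate,
        if_neg (by omega), add_zero, cycleType_def, Multiset.count_map]
      simp only [eq_comm, Function.comp_apply]
      rfl
    rw [filter_cycleLength_eq_biUnion σ l hl, Finset.card_biUnion, hcount,
      Finset.sum_const_nat fun c hc => (Finset.mem_filter.1 hc).2, mul_comm]
    intro c hc d hd hcd
    rw [Function.onFun, ← disjoint_iff_disjoint_support]
    exact cycleFactorsFinset_pairwise_disjoint σ (Finset.mem_filter.1 hc).1
      (Finset.mem_filter.1 hd).1 hcd

lemma cycleCount_conj (j : ℕ) : cycleCount (τ * σ * τ⁻¹) j = cycleCount σ j := by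
  have hconj : IsConj σ (τ * σ * τ⁻¹) := isConj_iff.2 ⟨τ, rfl⟩
  rw [cycleCount, ← partition_eq_of_isConj.1 hconj, cycleCount]

lemma mul_cycleCount_div_le_one : (l * cycleCount σ l : ℝ) / N ≤ 1 := by
  refine div_le_one_of_le₀ ?_ N.cast_nonneg
  rw [← Nat.cast_mul, ← card_cycleLength_eq]
  exact_mod_cast (Finset.card_le_univ _).trans (Fintype.card_fin N).le

end CycleLength

/-! ### Concentration of the cycle counts -/

section Mean

variable (θ κ : ℕ → ℝ) (N : ℕ)

/-- The expectation under the surrogate-spatial measure, as a linear functional. -/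
def mean : (Equiv.Perm (Fin N) → ℝ) →ₗ[ℝ] ℝ :=
  ∑ σ, permMass θ κ N σ • LinearMap.proj σ

lemma mean_apply (f : Equiv.Perm (Fin N) → ℝ) : mean θ κ N f = ∑ σ, permMass θ κ N σ * f σ := by
  simp [mean]

lemma factorial_mul_normConst :
    (N.factorial : ℝ) * normConst θ κ N = ∑ σ, cycleWeight θ κ N σ := by
  rw [normConst, ← mul_assoc, mul_one_div_cancel (by positivity), one_mul]

variable {θ κ} {N}

lemma mean_const (hpos : 0 < normConst θ κ N) (c : ℝ) : mean θ κ N (fun _ => c) = c := by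
  simp only [mean_apply, permMass, ← Finset.sum_mul, ← Finset.sum_div, ← factorial_mul_normConst]
  rw [div_self (by positivity), one_mul]

lemma permMass_nonneg (hθ : ∀ j, 1 ≤ j → 0 ≤ θ j) (hκ : ∀ j, 1 ≤ j → 0 ≤ κ j)
    (σ : Equiv.Perm (Fin N)) : 0 ≤ permMass θ κ N σ := by
  have hweight (σ : Equiv.Perm (Fin N)) : 0 ≤ cycleWeight θ κ N σ :=
    Finset.prod_nonneg fun j hj => by
      have := hθ j (Finset.mem_Icc.1 hj).1
      have := hκ j (Finset.mem_Icc.1 hj).1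
      positivity
  rw [permMass, factorial_mul_normConst]
  exact div_nonneg (hweight σ) (Finset.sum_nonneg fun σ _ => hweight σ)

lemma mean_mono (hθ : ∀ j, 1 ≤ j → 0 ≤ θ j) (hκ : ∀ j, 1 ≤ j → 0 ≤ κ j)
    {f g : Equiv.Perm (Fin N) → ℝ} (hfg : ∀ σ, f σ ≤ g σ) : mean θ κ N f ≤ mean θ κ N g := by
  rw [mean_apply, mean_apply]
  exact Finset.sum_le_sum fun σ _ => mul_le_mul_of_nonneg_left (hfg σ) (permMass_nonneg hθ hκ σ)

lemma abs_mean_le (hθ : ∀ j, 1 ≤ j → 0 ≤ θ j) (hκ : ∀ j, 1 ≤ j → 0 ≤ κ j)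
    (f : Equiv.Perm (Fin N) → ℝ) : |mean θ κ N f| ≤ mean θ κ N fun σ => |f σ| := by
  rw [abs_le, ← map_neg]
  exact ⟨mean_mono hθ hκ fun σ => neg_abs_le (f σ), mean_mono hθ hκ fun σ => le_abs_self (f σ)⟩

lemma mean_const_add_mul_add_mul (hpos : 0 < normConst θ κ N) (c a b : ℝ)
    (f g : Equiv.Perm (Fin N) → ℝ) :
    mean θ κ N (fun σ => c + (a * f σ + b * g σ)) =
      c + (a * mean θ κ N f + b * mean θ κ N g) := by
  change mean θ κ N ((fun _ => c) + (a • f + b • g)) = _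
  rw [map_add, map_add, map_smul, map_smul, mean_const hpos, smul_eq_mul, smul_eq_mul]

end Mean

section Tilt

variable {θ κ a : ℕ → ℝ} {r s : ℝ} {l : ℕ}

/-- The parameters `a` with `a l` multiplied by `exp s`: passing from `(θ, κ)` to the tilted
parameters multiplies the weight of `σ` by `exp (s C_l(σ))`. -/
def tilt (a : ℕ → ℝ) (l : ℕ) (s : ℝ) : ℕ → ℝ := Function.update a l (Real.exp s * a l)

lemma tilt_nonneg (ha : ∀ j, 1 ≤ j → 0 ≤ a j) (j : ℕ) (hj : 1 ≤ j) : 0 ≤ tilt a l s j := by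
  have := ha j hj
  unfold tilt
  obtain rfl | hjl := eq_or_ne j l
  · rw [Function.update_self]
    positivity
  · rwa [Function.update_of_ne hjl]

lemma hasSum_genCoeff_tilt_mul_pow (h : Summable fun j => genCoeff a j * r ^ j) (l : ℕ) (s : ℝ) :
    HasSum (fun j => genCoeff (tilt a l s) j * r ^ j)
      (genSum a r + (Real.exp s - 1) * (genCoeff a l * r ^ l)) := by
  rw [genSum]
  convert h.hasSum.add (hasSum_ite_eq l ((Real.exp s - 1) * (genCoeff a l * r ^ l))) using 2 with j
  obtain rfl | hjl := eq_or_ne j l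
  · simp only [genCoeff, tilt, Function.update_self]
    split_ifs <;> ring
  · simp [genCoeff, tilt, hjl]

lemma cycleWeight_tilt {N : ℕ} (hl : l ∈ Finset.Icc 1 N) (σ : Equiv.Perm (Fin N)) :
    cycleWeight (tilt θ l s) (tilt κ l s) N σ =
      cycleWeight θ κ N σ * Real.exp (s * cycleCount σ l) := by
  have hterm (j : ℕ) : tilt θ l s j + N * tilt κ l s j =
      (θ j + N * κ j) * if j = l then Real.exp s else 1 := by
    obtain rfl | hjl := eq_or_ne j l
    · simp only [tilt, Function.update_self, if_true]
      ring
    · simp [tilt, hjl]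
  simp only [cycleWeight, hterm, mul_pow, Finset.prod_mul_distrib, ite_pow, one_pow]
  rw [Finset.prod_ite_eq' _ l, if_pos hl, ← Real.exp_nat_mul, mul_comm s]

lemma mean_exp_cycleCount (θ κ : ℕ → ℝ) (s : ℝ) {N : ℕ} (hl : l ∈ Finset.Icc 1 N) :
    mean θ κ N (fun σ => Real.exp (s * cycleCount σ l)) =
      normConst (tilt θ l s) (tilt κ l s) N / normConst θ κ N := by
  have hfac : (N.factorial : ℝ) ≠ 0 := by positivity
  rw [← mul_div_mul_left _ _ hfac, factorial_mul_normConst, mean_apply, Finset.sum_div]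
  simp only [permMass, cycleWeight_tilt hl, div_mul_eq_mul_div]

lemma Admissible.tendsto_exp_mul_mean_exp_cycleCount (h : Admissible θ κ r) (hl : 1 ≤ l) {c : ℝ}
    (hc : (Real.exp s - 1) * (genCoeff κ l * r ^ l) < c) :
    Tendsto (fun N : ℕ => Real.exp (-(N * c)) * mean θ κ N fun σ => Real.exp (s * cycleCount σ l))
      atTop (𝓝 0) := by
  obtain ⟨ε, hε, hεc⟩ : ∃ ε > 0, (Real.exp s - 1) * (genCoeff κ l * r ^ l) + 3 * ε = c :=
    ⟨(c - (Real.exp s - 1) * (genCoeff κ l * r ^ l)) / 3, by linarith, by ring⟩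
  have hκ_tilt := hasSum_genCoeff_tilt_mul_pow h.summable_genCoeff_mul_pow l s
  have hθ_summable (x : ℝ) (hx : 0 ≤ x) (hxr : x < r) : Summable fun j => genCoeff θ j * x ^ j :=
    SurrogateSpatial.summable_genCoeff_mul_pow h.θ_nonneg hx
      (((ENNReal.ofReal_lt_ofReal_iff h.pos).2 hxr).trans_le h.le_genRadius)
  have hupper := eventually_normConst_le_exp (tilt_nonneg h.θ_nonneg (l := l) (s := s))
    (tilt_nonneg h.κ_nonneg (l := l) (s := s)) h.pos
    (fun x hx hxr => (hasSum_genCoeff_tilt_mul_pow (hθ_summable x hx hxr) l s).summable)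
    hκ_tilt.summable (lt_add_of_pos_right _ hε)
  have hlower := h.eventually_exp_le_normConst (sub_lt_self _ hε)
  have hdecay : Tendsto (fun N : ℕ => Real.exp (-(N * ε))) atTop (𝓝 0) :=
    Real.tendsto_exp_neg_atTop_nhds_zero.comp (tendsto_natCast_atTop_atTop.atTop_mul_const hε)
  refine squeeze_zero' (Eventually.of_forall fun N => ?_) ?_ hdecay
  · rw [mean_apply]
    exact mul_nonneg (Real.exp_nonneg _) (Finset.sum_nonneg fun σ _ =>
      mul_nonneg (permMass_nonneg h.θ_nonneg h.κ_nonneg σ) (Real.exp_nonneg _))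
  filter_upwards [hupper, hlower, eventually_ge_atTop l] with N hN_upper hN_lower hlN
  rw [mean_exp_cycleCount θ κ s (Finset.mem_Icc.2 ⟨hl, hlN⟩)]
  refine (mul_le_mul_of_nonneg_left (div_le_div₀ (Real.exp_nonneg _) hN_upper (Real.exp_pos _)
    hN_lower) (Real.exp_nonneg _)).trans_eq ?_
  rw [← Real.exp_sub, ← Real.exp_add, genSum, hκ_tilt.tsum_eq, ← hεc]
  congr 1
  ring

end Tilt

lemma exists_exp_sub_one_mul_lt {q ε : ℝ} (hq : 0 ≤ q) (hq1 : q ≤ 1) (hε : 0 < ε) :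
    ∃ s > 0, (Real.exp s - 1) * q < s * (q + ε) ∧ (Real.exp (-s) - 1) * q < s * (ε - q) := by
  refine ⟨min 1 (ε / 2), by positivity, ?_⟩
  set s := min 1 (ε / 2)
  have hs : 0 < s := by positivity
  have hs1 : |s| ≤ 1 := (abs_of_pos hs).trans_le (min_le_left _ _)
  have hexp (t : ℝ) (ht : |t| ≤ 1) : (Real.exp t - 1 - t) * q ≤ t ^ 2 :=
    (mul_le_mul_of_nonneg_right ((le_abs_self _).trans (Real.abs_exp_sub_one_sub_id_le ht))
      hq).trans (mul_le_of_le_one_right (sq_nonneg t) hq1)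
  have hsq : s ^ 2 < s * ε := by
    have : s ≤ ε / 2 := min_le_right _ _
    nlinarith
  constructor
  · linarith [hexp s hs1]
  · linarith [hexp (-s) (by rwa [abs_neg]), neg_sq s]

lemma abs_le_add_exp_add_exp {t y ε : ℝ} (hε : 0 ≤ ε) (ht : 0 ≤ t) (hy : |y| ≤ 1) :
    |y| ≤ ε + (Real.exp (t * (y - ε)) + Real.exp (t * (-y - ε))) := by
  have hpos := Real.exp_pos (t * (y - ε))
  have hpos' := Real.exp_pos (t * (-y - ε))
  rcases le_or_gt |y| ε with h | h
  · linarith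
  rcases lt_abs.1 h with h | h
  · linarith [Real.one_le_exp (mul_nonneg ht (sub_pos.2 h).le)]
  · linarith [Real.one_le_exp (mul_nonneg ht (sub_pos.2 h).le)]

section Concentration

variable {θ κ : ℕ → ℝ} {r : ℝ} {l : ℕ}

lemma Admissible.genCoeff_mul_pow_mem_Icc (h : Admissible θ κ r) (l : ℕ) :
    genCoeff κ l * r ^ l ∈ Set.Icc (0 : ℝ) 1 :=
  ⟨mul_nonneg (genCoeff_nonneg h.κ_nonneg l) (pow_nonneg h.pos.le l),
    (genCoeff_mul_pow_le_limitWeight h.κ_nonneg h.pos.le l).trans (h.limitWeight_le_one l)⟩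

lemma abs_cycleCount_div_sub_le_add_exp {N : ℕ} (hN : N ≠ 0) (hl : 1 ≤ l) {q s ε : ℝ}
    (hq : q ∈ Set.Icc (0 : ℝ) 1) (hs : 0 ≤ s) (hε : 0 ≤ ε) (σ : Equiv.Perm (Fin N)) :
    |(cycleCount σ l : ℝ) / N - q| ≤
      ε + (Real.exp (-(N * (s * (q + ε)))) * Real.exp (s * cycleCount σ l) +
        Real.exp (-(N * (s * (ε - q)))) * Real.exp (-s * cycleCount σ l)) := by
  have hcount : (cycleCount σ l : ℝ) / N ∈ Set.Icc (0 : ℝ) 1 := by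
    refine ⟨by positivity, le_trans ?_ (mul_cycleCount_div_le_one σ l)⟩
    gcongr
    exact le_mul_of_one_le_left (Nat.cast_nonneg _) (by exact_mod_cast hl)
  have hbound := abs_le_add_exp_add_exp (t := N * s) hε (by positivity)
    ((abs_sub_le_of_le_of_le hcount.1 hcount.2 hq.1 hq.2).trans_eq (sub_zero 1))
  rw [← Real.exp_add, ← Real.exp_add]
  convert hbound using 4 <;> field_simp <;> ring

lemma Admissible.tendsto_mean_abs_cycleCount_div_sub (h : Admissible θ κ r) (hl : 1 ≤ l) :
    Tendsto (fun N : ℕ => mean θ κ N fun σ => |(cycleCount σ l : ℝ) / N - genCoeff κ l * r ^ l|)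
      atTop (𝓝 0) := by
  have hq := h.genCoeff_mul_pow_mem_Icc l
  set q := genCoeff κ l * r ^ l
  have hnonneg (N : ℕ) : 0 ≤ mean θ κ N fun σ => |(cycleCount σ l : ℝ) / N - q| := by
    rw [mean_apply]
    exact Finset.sum_nonneg fun σ _ =>
      mul_nonneg (permMass_nonneg h.θ_nonneg h.κ_nonneg σ) (abs_nonneg _)
  refine tendsto_order.2 ⟨fun b hb => Eventually.of_forall fun N => hb.trans_le (hnonneg N),
    fun b hb => ?_⟩
  obtain ⟨s, hs, hs_upper, hs_lower⟩ := exists_exp_sub_one_mul_lt hq.1 hq.2 (half_pos hb)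
  have htail := (h.tendsto_exp_mul_mean_exp_cycleCount hl hs_upper).add
    (h.tendsto_exp_mul_mean_exp_cycleCount hl hs_lower)
  rw [add_zero] at htail
  filter_upwards [htail.eventually_lt_const (half_pos hb), eventually_ne_atTop 0,
    eventually_normConst_pos h.θ_nonneg h.κ_nonneg h.nonArithmetic] with N hN_tail hN hN_pos
  refine (mean_mono h.θ_nonneg h.κ_nonneg
    (abs_cycleCount_div_sub_le_add_exp hN hl hq hs.le (half_pos hb).le)).trans_lt ?_
  rw [mean_const_add_mul_add_mul hN_pos]
  linarith

lemma abs_prod_sub_prod_le {ι : Type*} (s : Finset ι) {a b : ι → ℝ}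
    (ha : ∀ i, a i ∈ Set.Icc (0 : ℝ) 1) (hb : ∀ i, b i ∈ Set.Icc (0 : ℝ) 1) :
    |∏ i ∈ s, a i - ∏ i ∈ s, b i| ≤ ∑ i ∈ s, |a i - b i| := by
  classical
  induction s using Finset.induction_on with
  | empty => simp
  | insert i s hi ih =>
    rw [Finset.prod_insert hi, Finset.prod_insert hi, Finset.sum_insert hi]
    calc |a i * ∏ j ∈ s, a j - b i * ∏ j ∈ s, b j|
        = |(a i - b i) * ∏ j ∈ s, a j + b i * (∏ j ∈ s, a j - ∏ j ∈ s, b j)| := by ring_nf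
      _ ≤ |a i - b i| * |∏ j ∈ s, a j| + |b i| * |∏ j ∈ s, a j - ∏ j ∈ s, b j| := by
          rw [← abs_mul, ← abs_mul]
          exact abs_add_le _ _
      _ ≤ |a i - b i| * 1 + 1 * ∑ j ∈ s, |a j - b j| := by
          gcongr
          · rw [abs_of_nonneg (Finset.prod_nonneg fun j _ => (ha j).1)]
            exact Finset.prod_le_one (fun j _ => (ha j).1) fun j _ => (ha j).2
          · rw [abs_of_nonneg (hb i).1]
            exact (hb i).2
      _ = _ := by ring

lemma Admissible.tendsto_mean_abs_mul_cycleCount_div_sub (h : Admissible θ κ r) (l : ℕ) :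
    Tendsto (fun N : ℕ => mean θ κ N fun σ => |(l * cycleCount σ l : ℝ) / N - limitWeight κ r l|)
      atTop (𝓝 0) := by
  rcases l.eq_zero_or_pos with rfl | hl
  · simp [limitWeight, mean_apply]
  convert (h.tendsto_mean_abs_cycleCount_div_sub hl).const_mul (l : ℝ) using 2 with N
  · rw [← smul_eq_mul, ← map_smul]
    congr 1
    ext σ
    rw [Pi.smul_apply, smul_eq_mul, limitWeight, mul_div_assoc, ← mul_sub, abs_mul, Nat.abs_cast]
  · rw [mul_zero]

lemma Admissible.tendsto_mean_prod_cycleCount (h : Admissible θ κ r) {ι : Type*} [Fintype ι]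
    (ℓ : ι → ℕ) :
    Tendsto (fun N : ℕ => mean θ κ N fun σ => ∏ i, ((ℓ i * cycleCount σ (ℓ i) : ℝ) / N))
      atTop (𝓝 (∏ i, limitWeight κ r (ℓ i))) := by
  have hsum := tendsto_finsetSum Finset.univ fun i _ =>
    h.tendsto_mean_abs_mul_cycleCount_div_sub (ℓ i)
  rw [Finset.sum_const_zero] at hsum
  refine tendsto_iff_dist_tendsto_zero.2 (squeeze_zero' (.of_forall fun _ => dist_nonneg) ?_ hsum)
  filter_upwards [eventually_normConst_pos h.θ_nonneg h.κ_nonneg h.nonArithmetic] with N hN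
  rw [Real.dist_eq, ← mean_const hN (∏ i, limitWeight κ r (ℓ i)), ← map_sub, ← map_sum]
  refine (abs_mean_le h.θ_nonneg h.κ_nonneg _).trans (mean_mono h.θ_nonneg h.κ_nonneg fun σ => ?_)
  rw [Finset.sum_apply]
  exact abs_prod_sub_prod_le _ (fun i => ⟨by positivity, mul_cycleCount_div_le_one σ (ℓ i)⟩)
    fun i => ⟨h.limitWeight_nonneg _, h.limitWeight_le_one _⟩

end Concentration

/-! ### The joint law of the lengths of the cycles through given points -/

section Prob

variable {θ κ : ℕ → ℝ} {N : ℕ}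

lemma prob_eq_mean (θ κ : ℕ → ℝ) (A : Set (Equiv.Perm (Fin N))) :
    prob θ κ N A = mean θ κ N (A.indicator 1) := by
  classical
  simp [prob, mean_apply, Set.indicator_apply]

lemma prob_nonneg (hθ : ∀ j, 1 ≤ j → 0 ≤ θ j) (hκ : ∀ j, 1 ≤ j → 0 ≤ κ j)
    (A : Set (Equiv.Perm (Fin N))) : 0 ≤ prob θ κ N A :=
  Finset.sum_nonneg fun σ _ => by
    split_ifs
    exacts [permMass_nonneg hθ hκ σ, le_rfl]

lemma prob_mono (hθ : ∀ j, 1 ≤ j → 0 ≤ θ j) (hκ : ∀ j, 1 ≤ j → 0 ≤ κ j)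
    {A B : Set (Equiv.Perm (Fin N))} (hAB : A ⊆ B) : prob θ κ N A ≤ prob θ κ N B := by
  rw [prob_eq_mean, prob_eq_mean]
  exact mean_mono hθ hκ (Set.indicator_le_indicator_of_subset hAB fun _ => zero_le_one)

lemma prob_univ (hpos : 0 < normConst θ κ N) : prob θ κ N Set.univ = 1 := by
  rw [prob_eq_mean, Set.indicator_univ]
  exact mean_const hpos 1

lemma prob_mem_Icc (hθ : ∀ j, 1 ≤ j → 0 ≤ θ j) (hκ : ∀ j, 1 ≤ j → 0 ≤ κ j)
    (hpos : 0 < normConst θ κ N) (A : Set (Equiv.Perm (Fin N))) :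
    prob θ κ N A ∈ Set.Icc (0 : ℝ) 1 :=
  ⟨prob_nonneg hθ hκ A, (prob_mono hθ hκ A.subset_univ).trans_eq (prob_univ hpos)⟩

open Classical in
lemma sum_prob (θ κ : ℕ → ℝ) {ι : Type*} (s : Finset ι) (A : ι → Set (Equiv.Perm (Fin N))) :
    ∑ i ∈ s, prob θ κ N (A i) = mean θ κ N fun σ => ((s.filter fun i => σ ∈ A i).card : ℝ) := by
  simp only [prob_eq_mean, ← map_sum]
  congr 1
  ext σ
  simp [Set.indicator_apply, Finset.sum_apply]

lemma prob_setOf_mem_finset (θ κ : ℕ → ℝ) {α : Type*} (X : Equiv.Perm (Fin N) → α)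
    (s : Finset α) : prob θ κ N {σ | X σ ∈ s} = ∑ a ∈ s, prob θ κ N {σ | X σ = a} := by
  classical
  rw [sum_prob, prob_eq_mean]
  congr 1
  ext σ
  by_cases hσ : X σ ∈ s <;> simp [Finset.filter_eq, hσ]

lemma abs_prob_sub_prob_le_sum (hθ : ∀ j, 1 ≤ j → 0 ≤ θ j) (hκ : ∀ j, 1 ≤ j → 0 ≤ κ j)
    {A B : Set (Equiv.Perm (Fin N))} {ι : Type*} (s : Finset ι)
    (E : ι → Set (Equiv.Perm (Fin N))) (hE : ∀ σ, (∀ i ∈ s, σ ∉ E i) → (σ ∈ A ↔ σ ∈ B)) :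
    |prob θ κ N A - prob θ κ N B| ≤ ∑ i ∈ s, prob θ κ N (E i) := by
  classical
  rw [prob_eq_mean, prob_eq_mean, ← map_sub, sum_prob]
  refine (abs_mean_le hθ hκ _).trans (mean_mono hθ hκ fun σ => ?_)
  rw [Pi.sub_apply, Set.indicator_apply, Set.indicator_apply]
  by_cases hσ : ∀ i ∈ s, σ ∉ E i
  · simp [hE σ hσ]
  · push Not at hσ
    obtain ⟨i, hi, hσi⟩ := hσ
    have hcard : (1 : ℝ) ≤ (s.filter fun i => σ ∈ E i).card := by
      exact_mod_cast Finset.card_pos.2 ⟨i, Finset.mem_filter.2 ⟨hi, hσi⟩⟩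
    refine le_trans ?_ hcard
    split_ifs <;> simp

lemma prob_conj (θ κ : ℕ → ℝ) (τ : Equiv.Perm (Fin N)) (A : Set (Equiv.Perm (Fin N))) :
    prob θ κ N {σ | τ * σ * τ⁻¹ ∈ A} = prob θ κ N A := by
  have hmass (σ : Equiv.Perm (Fin N)) : permMass θ κ N (τ * σ * τ⁻¹) = permMass θ κ N σ := by
    simp only [permMass, cycleWeight, cycleCount_conj]
  rw [prob_eq_mean, prob_eq_mean, mean_apply, mean_apply,
    ← Equiv.sum_comp (MulAut.conj τ).toEquiv fun σ => permMass θ κ N σ * A.indicator 1 σ]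
  refine Finset.sum_congr rfl fun σ _ => ?_
  simp only [MulEquiv.toEquiv_eq_coe, MulEquiv.coe_toEquiv, MulAut.conj_apply, hmass]
  rfl

end Prob

section CycleLengthLaw

variable {θ κ : ℕ → ℝ} {N m : ℕ}

lemma prob_cycleLength_eq_of_embedding (θ κ : ℕ → ℝ) (ℓ : Fin m → ℕ) (x y : Fin m ↪ Fin N) :
    prob θ κ N {σ | ∀ i, cycleLength σ (x i) = ℓ i} =
      prob θ κ N {σ | ∀ i, cycleLength σ (y i) = ℓ i} := by
  obtain ⟨τ, rfl⟩ := (Equiv.Perm.isMultiplyPretransitive (Fin N) m).exists_smul_eq x y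
  rw [← prob_conj θ κ τ {σ | ∀ i, cycleLength σ ((τ • x) i) = ℓ i}]
  simp only [Set.mem_ofPred_eq, Function.Embedding.smul_apply, Equiv.Perm.smul_def,
    cycleLength_conj]

lemma sum_prob_cycleLength (θ κ : ℕ → ℝ) (N : ℕ) (ℓ : Fin m → ℕ) :
    ∑ x : Fin m → Fin N, prob θ κ N {σ | ∀ i, cycleLength σ (x i) = ℓ i} =
      mean θ κ N fun σ => ∏ i, (ℓ i * cycleCount σ (ℓ i) : ℝ) := by
  classical
  rw [sum_prob]
  congr 1
  ext σ
  have hpi : (Finset.univ.filter fun x : Fin m → Fin N => ∀ i, cycleLength σ (x i) = ℓ i) =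
      Fintype.piFinset fun i => Finset.univ.filter fun y => cycleLength σ y = ℓ i := by
    ext x
    simp
  simp only [Set.mem_ofPred_eq, hpi, Fintype.card_piFinset, card_cycleLength_eq]
  push_cast
  rfl

lemma abs_card_mul_sub_sum_le {ι : Type*} [Fintype ι] (s : Finset ι) {f : ι → ℝ} {a : ℝ}
    (hf : ∀ i, f i ∈ Set.Icc (0 : ℝ) 1) (ha : a ∈ Set.Icc (0 : ℝ) 1) (hs : ∀ i ∈ s, f i = a) :
    |Fintype.card ι * a - ∑ i, f i| ≤ Fintype.card ι - s.card := by
  classical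
  calc |Fintype.card ι * a - ∑ i, f i| = |∑ i, (a - f i)| := by simp
    _ = |∑ i ∈ sᶜ, (a - f i)| := by
        rw [← Finset.sum_add_sum_compl s,
          Finset.sum_eq_zero fun i hi => sub_eq_zero.2 (hs i hi).symm, zero_add]
    _ ≤ ∑ _i ∈ sᶜ, (1 : ℝ) := (Finset.abs_sum_le_sum_abs _ _).trans (Finset.sum_le_sum fun i _ =>
        (abs_sub_le_of_le_of_le ha.1 ha.2 (hf i).1 (hf i).2).trans_eq (sub_zero 1))
    _ = Fintype.card ι - s.card := by
        rw [Finset.sum_const, nsmul_one, Finset.card_compl, Nat.cast_sub s.card_le_univ]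

lemma card_filter_injective (m N : ℕ) :
    (Finset.univ.filter fun x : Fin m → Fin N => x.Injective).card = N.descFactorial m := by
  rw [← Fintype.card_subtype,
    Fintype.card_congr (Equiv.subtypeInjectiveEquivEmbedding (Fin m) (Fin N)),
    Fintype.card_embedding_eq, Fintype.card_fin, Fintype.card_fin]

lemma abs_prob_cycleLength_sub_mean_le (hθ : ∀ j, 1 ≤ j → 0 ≤ θ j) (hκ : ∀ j, 1 ≤ j → 0 ≤ κ j)
    (hpos : 0 < normConst θ κ N) (hN : N ≠ 0) (ℓ : Fin m → ℕ) (y : Fin m ↪ Fin N) :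
    |prob θ κ N {σ | ∀ i, cycleLength σ (y i) = ℓ i} -
      mean θ κ N (fun σ => ∏ i, ((ℓ i * cycleCount σ (ℓ i) : ℝ) / N))| ≤
      1 - (N.descFactorial m : ℝ) / (N : ℝ) ^ m := by
  classical
  have havg := abs_card_mul_sub_sum_le (Finset.univ.filter fun x : Fin m → Fin N => x.Injective)
    (fun x => prob_mem_Icc hθ hκ hpos {σ | ∀ i, cycleLength σ (x i) = ℓ i})
    (prob_mem_Icc hθ hκ hpos {σ | ∀ i, cycleLength σ (y i) = ℓ i}) fun x hx =>
      prob_cycleLength_eq_of_embedding θ κ ℓ ⟨x, (Finset.mem_filter.1 hx).2⟩ y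
  have hmean : mean θ κ N (fun σ => ∏ i, ((ℓ i * cycleCount σ (ℓ i) : ℝ) / N)) =
      ((N : ℝ) ^ m)⁻¹ * mean θ κ N fun σ => ∏ i, (ℓ i * cycleCount σ (ℓ i) : ℝ) := by
    rw [← smul_eq_mul, ← map_smul]
    congr 1
    ext σ
    rw [Pi.smul_apply, smul_eq_mul, Finset.prod_div_distrib, Finset.prod_const, Finset.card_univ,
      Fintype.card_fin, div_eq_inv_mul]
  have hNm : (0 : ℝ) < (N : ℝ) ^ m := by positivity
  rw [sum_prob_cycleLength, card_filter_injective, Fintype.card_fun, Fintype.card_fin,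
    Fintype.card_fin, Nat.cast_pow] at havg
  rw [hmean, ← mul_le_mul_iff_right₀ hNm]
  calc _ = |(N : ℝ) ^ m * prob θ κ N {σ | ∀ i, cycleLength σ (y i) = ℓ i} -
        mean θ κ N fun σ => ∏ i, (ℓ i * cycleCount σ (ℓ i) : ℝ)| := by
        nth_rw 1 [← abs_of_pos hNm]
        rw [← abs_mul, mul_sub, mul_inv_cancel_left₀ hNm.ne']
    _ ≤ (N : ℝ) ^ m - N.descFactorial m := havg
    _ = _ := by rw [mul_sub, mul_one, mul_div_cancel₀ _ hNm.ne']

end CycleLengthLaw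

section SameCycle

variable {θ κ : ℕ → ℝ} {N : ℕ} {a b c : Fin N}

lemma prob_sameCycle_eq_of_ne (θ κ : ℕ → ℝ) (hab : a ≠ b) (hac : a ≠ c) (L : ℕ) :
    prob θ κ N {σ | σ.SameCycle a b ∧ cycleLength σ a ≤ L} =
      prob θ κ N {σ | σ.SameCycle a c ∧ cycleLength σ a ≤ L} := by
  rw [← prob_conj θ κ (Equiv.swap b c) {σ | σ.SameCycle a c ∧ cycleLength σ a ≤ L}]
  congr 1
  ext σ
  have hfix : Equiv.swap b c a = a := Equiv.swap_apply_of_ne_of_ne hab hac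
  have hlength := cycleLength_conj σ (Equiv.swap b c) a
  rw [hfix] at hlength
  rw [Set.mem_ofPred_eq, Set.mem_ofPred_eq, Set.mem_ofPred_eq, hlength, Equiv.Perm.sameCycle_conj,
    Equiv.swap_inv, hfix, Equiv.swap_apply_right]

lemma sum_prob_sameCycle_le (hθ : ∀ j, 1 ≤ j → 0 ≤ θ j) (hκ : ∀ j, 1 ≤ j → 0 ≤ κ j)
    (hpos : 0 < normConst θ κ N) (a : Fin N) (L : ℕ) :
    ∑ c, prob θ κ N {σ | σ.SameCycle a c ∧ cycleLength σ a ≤ L} ≤ L := by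
  classical
  rw [sum_prob]
  refine (mean_mono hθ hκ fun σ => ?_).trans_eq (mean_const hpos (L : ℝ))
  rw [Nat.cast_le]
  by_cases hL : cycleLength σ a ≤ L
  · simp only [Set.mem_ofPred_eq, hL, and_true]
    exact hL
  · simp [hL]

lemma prob_sameCycle_le (hθ : ∀ j, 1 ≤ j → 0 ≤ θ j) (hκ : ∀ j, 1 ≤ j → 0 ≤ κ j)
    (hpos : 0 < normConst θ κ N) (hab : a ≠ b) (L : ℕ) :
    prob θ κ N {σ | σ.SameCycle a b ∧ cycleLength σ a ≤ L} ≤ L / ((N : ℝ) - 1) := by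
  have hN : 2 ≤ N := by
    have := Fin.val_ne_of_ne hab
    omega
  have hN1 : (0 : ℝ) < (N : ℝ) - 1 := by
    rw [sub_pos]
    exact_mod_cast hN
  rw [le_div_iff₀' hN1]
  refine le_trans ?_ (sum_prob_sameCycle_le hθ hκ hpos a L)
  calc ((N : ℝ) - 1) * prob θ κ N {σ | σ.SameCycle a b ∧ cycleLength σ a ≤ L}
      = ∑ _c ∈ Finset.univ.erase a, prob θ κ N {σ | σ.SameCycle a b ∧ cycleLength σ a ≤ L} := by
        rw [Finset.sum_const, Finset.card_erase_of_mem (Finset.mem_univ a), Finset.card_univ,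
          Fintype.card_fin, nsmul_eq_mul, Nat.cast_sub (by omega), Nat.cast_one]
    _ = ∑ c ∈ Finset.univ.erase a, prob θ κ N {σ | σ.SameCycle a c ∧ cycleLength σ a ≤ L} :=
        Finset.sum_congr rfl fun c hc =>
          prob_sameCycle_eq_of_ne θ κ hab (Finset.ne_of_mem_erase hc).symm L
    _ ≤ ∑ c, prob θ κ N {σ | σ.SameCycle a c ∧ cycleLength σ a ≤ L} :=
        Finset.sum_le_univ_sum_of_nonneg fun c => prob_nonneg hθ hκ _

end SameCycle

/-! ### The lexicographic cycle lengths -/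

section LexLength

open Equiv.Perm

variable {N m k : ℕ} {σ : Equiv.Perm (Fin N)} {x : Fin N}

lemma mem_remaining_succ_iff :
    x ∈ remaining σ (k + 1) ↔ ∃ h : (remaining σ k).Nonempty, x ∈ remaining σ k ∧
      ¬ σ.SameCycle ((remaining σ k).min' h) x := by
  rw [remaining]
  split_ifs with h <;> simp [h]

lemma lexLength_eq_cycleLength_min' (h : (remaining σ k).Nonempty) :
    lexLength σ k = cycleLength σ ((remaining σ k).min' h) := by
  rw [lexLength, dif_pos h]
  rfl

lemma le_of_mem_remaining (hx : x ∈ remaining σ k) : k ≤ (x : ℕ) := by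
  induction k generalizing x with
  | zero => exact Nat.zero_le _
  | succ k ih =>
    obtain ⟨hne, hxk, hnot⟩ := mem_remaining_succ_iff.1 hx
    have hmin_le : ((remaining σ k).min' hne : ℕ) ≤ x := Finset.min'_le _ _ hxk
    have hmin_ne : ((remaining σ k).min' hne : ℕ) ≠ x := fun h => by
      rw [Fin.ext h] at hnot
      exact hnot (SameCycle.refl σ x)
    have := ih ((remaining σ k).min'_mem hne)
    omega

lemma exists_lexLength_eq_of_notMem_remaining (hx : x ∉ remaining σ k) :
    ∃ i < k, lexLength σ i = cycleLength σ x := by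
  induction k with
  | zero => simp [remaining] at hx
  | succ k ih =>
    by_cases hxk : x ∈ remaining σ k
    · refine ⟨k, k.lt_succ_self, ?_⟩
      rw [lexLength_eq_cycleLength_min' ⟨x, hxk⟩]
      exact cycleLength_eq_of_sameCycle <| by_contra fun hnot =>
        hx (mem_remaining_succ_iff.2 ⟨⟨x, hxk⟩, hxk, hnot⟩)
    · obtain ⟨i, hi, hlength⟩ := ih hxk
      exact ⟨i, hi.trans k.lt_succ_self, hlength⟩

lemma exists_lexLength_eq_cycleLength (hx : (x : ℕ) < m) :
    ∃ i : Fin m, lexLength σ i = cycleLength σ x := by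
  obtain ⟨i, hi, hlength⟩ := exists_lexLength_eq_of_notMem_remaining (σ := σ)
    fun h => (le_of_mem_remaining h).not_gt hx
  exact ⟨⟨i, hi⟩, hlength⟩

lemma min'_remaining_self (hx : x ∈ remaining σ x) : (remaining σ x).min' ⟨x, hx⟩ = x :=
  le_antisymm (Finset.min'_le _ _ hx) (le_of_mem_remaining (Finset.min'_mem _ _))

lemma mem_remaining_of_forall_not_sameCycle
    (hdistinct : ∀ y z : Fin N, y < z → (z : ℕ) < k → ¬ σ.SameCycle y z)
    (hx : ∀ y : Fin N, (y : ℕ) < k → ¬ σ.SameCycle y x) : x ∈ remaining σ k := by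
  induction k generalizing x with
  | zero => simp [remaining]
  | succ k ih =>
    have hkx : k < (x : ℕ) := by
      by_contra! h
      exact hx x (by omega) (SameCycle.refl σ x)
    have hrem {w : Fin N} := ih (x := w) fun y z hyz hz => hdistinct y z hyz (by omega)
    have hk : (⟨k, hkx.trans x.2⟩ : Fin N) ∈ remaining σ k :=
      hrem fun y hy => hdistinct y _ hy k.lt_succ_self
    refine mem_remaining_succ_iff.2 ⟨⟨_, hk⟩, hrem fun y hy => hx y (by omega), ?_⟩
    rw [min'_remaining_self hk]
    exact hx _ k.lt_succ_self

lemma lexLength_eq_cycleLength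
    (hdistinct : ∀ y z : Fin N, y < z → z ≤ x → ¬ σ.SameCycle y z) :
    lexLength σ x = cycleLength σ x := by
  have hx : x ∈ remaining σ x := mem_remaining_of_forall_not_sameCycle
    (fun y z hyz hz => hdistinct y z hyz (le_of_lt hz)) fun y hy => hdistinct y x hy le_rfl
  rw [lexLength_eq_cycleLength_min' ⟨x, hx⟩, min'_remaining_self hx]

lemma forall_lexLength_eq_iff (hm : m ≤ N) {ℓ : Fin m → ℕ} {L : ℕ} (hL : ∀ i, ℓ i ≤ L)
    (hσ : ∀ i j : Fin m, i ≠ j → σ.SameCycle (Fin.castLE hm i) (Fin.castLE hm j) →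
      L < cycleLength σ (Fin.castLE hm i)) :
    (∀ i : Fin m, lexLength σ i = ℓ i) ↔ ∀ i, cycleLength σ (Fin.castLE hm i) = ℓ i := by
  by_cases hdistinct : ∀ i j : Fin m, i ≠ j → ¬ σ.SameCycle (Fin.castLE hm i) (Fin.castLE hm j)
  · refine forall_congr' fun i => ?_
    rw [← lexLength_eq_cycleLength (x := Fin.castLE hm i) fun y z hyz hz => ?_, Fin.val_castLE]
    have hzm : (z : ℕ) < m := lt_of_le_of_lt hz i.2
    exact hdistinct ⟨y, lt_trans hyz hzm⟩ ⟨z, hzm⟩ (Fin.ne_of_lt hyz)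
  · push Not at hdistinct
    obtain ⟨i, j, hij, hsame⟩ := hdistinct
    have hlong := hσ i j hij hsame
    obtain ⟨k, hk⟩ := exists_lexLength_eq_cycleLength (σ := σ) (x := Fin.castLE hm i) i.2
    exact iff_of_false (fun h => (hk ▸ (h k).trans_le (hL k)).not_gt hlong)
      fun h => ((h i).trans_le (hL i)).not_gt hlong

end LexLength

section LexLengthLaw

variable {θ κ : ℕ → ℝ} {r : ℝ} {N m : ℕ}

lemma abs_prob_lexLength_sub_le (hθ : ∀ j, 1 ≤ j → 0 ≤ θ j) (hκ : ∀ j, 1 ≤ j → 0 ≤ κ j)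
    (hpos : 0 < normConst θ κ N) (hN : N ≠ 0) (hm : m ≤ N) {ℓ : Fin m → ℕ} {L : ℕ}
    (hL : ∀ i, ℓ i ≤ L) :
    |prob θ κ N {σ | ∀ i : Fin m, lexLength σ i = ℓ i} -
      prob θ κ N {σ | ∀ i, cycleLength σ (Fin.castLE hm i) = ℓ i}| ≤
      (m * m : ℕ) * (L / ((N : ℝ) - 1)) := by
  classical
  let s : Finset (Fin m × Fin m) := Finset.univ.filter fun p => p.1 ≠ p.2
  let E (p : Fin m × Fin m) : Set (Equiv.Perm (Fin N)) :=
    {σ | σ.SameCycle (Fin.castLE hm p.1) (Fin.castLE hm p.2) ∧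
      cycleLength σ (Fin.castLE hm p.1) ≤ L}
  have hE (p) (hp : p ∈ s) : prob θ κ N (E p) ≤ L / ((N : ℝ) - 1) :=
    prob_sameCycle_le hθ hκ hpos
      (fun h => (Finset.mem_filter.1 hp).2 (Fin.castLE_injective hm h)) L
  have hcard : s.card ≤ m * m := s.card_le_univ.trans_eq (by simp)
  have hN1 : (0 : ℝ) ≤ (N : ℝ) - 1 := sub_nonneg.2 (Nat.one_le_cast.2 (Nat.pos_of_ne_zero hN))
  calc _ ≤ ∑ p ∈ s, prob θ κ N (E p) := abs_prob_sub_prob_le_sum hθ hκ s E fun σ hσ =>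
        forall_lexLength_eq_iff hm hL fun i j hij hsame => not_le.1 fun hle =>
          hσ (i, j) (Finset.mem_filter.2 ⟨Finset.mem_univ _, hij⟩) ⟨hsame, hle⟩
    _ ≤ s.card * (L / ((N : ℝ) - 1)) :=
        (Finset.sum_le_card_nsmul s _ _ hE).trans_eq (nsmul_eq_mul _ _)
    _ ≤ (m * m : ℕ) * (L / ((N : ℝ) - 1)) := by gcongr

lemma tendsto_descFactorial_div_pow (m : ℕ) :
    Tendsto (fun N : ℕ => (N.descFactorial m : ℝ) / (N : ℝ) ^ m) atTop (𝓝 1) := by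
  refine (isEquivalent_iff_tendsto_one ?_).1 (isEquivalent_descFactorial m)
  filter_upwards [eventually_ne_atTop 0] with N hN
  positivity

lemma Admissible.tendsto_prob_lexLength_eq (h : Admissible θ κ r) (ℓ : Fin m → ℕ) :
    Tendsto (fun N : ℕ => prob θ κ N {σ | ∀ i : Fin m, lexLength σ i = ℓ i})
      atTop (𝓝 (∏ i, limitWeight κ r (ℓ i))) := by
  have herr : Tendsto (fun N : ℕ => ((m * m : ℕ) * ((∑ i, ℓ i : ℕ) / ((N : ℝ) - 1)) : ℝ) +
      (1 - (N.descFactorial m : ℝ) / (N : ℝ) ^ m)) atTop (𝓝 0) := by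
    have hdiv : Tendsto (fun N : ℕ => ((∑ i, ℓ i : ℕ) : ℝ) / ((N : ℝ) - 1)) atTop (𝓝 0) :=
      tendsto_const_nhds.div_atTop
        (tendsto_atTop_add_const_right _ (-1) tendsto_natCast_atTop_atTop)
    simpa using (hdiv.const_mul ((m * m : ℕ) : ℝ)).add
      ((tendsto_descFactorial_div_pow m).const_sub 1)
  refine tendsto_of_tendsto_of_dist (h.tendsto_mean_prod_cycleCount ℓ)
    (squeeze_zero' (Eventually.of_forall fun _ => dist_nonneg) ?_ herr)
  filter_upwards [eventually_normConst_pos h.θ_nonneg h.κ_nonneg h.nonArithmetic,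
    eventually_ge_atTop m, eventually_ne_atTop 0] with N hpos hm hN
  rw [dist_comm, Real.dist_eq]
  exact (abs_sub_le _ _ _).trans <| add_le_add
    (abs_prob_lexLength_sub_le h.θ_nonneg h.κ_nonneg hpos hN hm fun i =>
      Finset.single_le_sum (fun _ _ => Nat.zero_le _) (Finset.mem_univ i))
    (abs_prob_cycleLength_sub_mean_le h.θ_nonneg h.κ_nonneg hpos hN ℓ (Fin.castLEEmb hm))

end LexLengthLaw

/-! ### Asymptotic independence -/

section ProductLimit

lemma tendsto_of_eventually_between {ι : Type*} {l : Filter ι} {f : ι → ℝ} {g h : ℕ → ι → ℝ}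
    {a b : ℕ → ℝ} {x : ℝ} (hgf : ∀ M, ∀ᶠ i in l, g M i ≤ f i) (hfh : ∀ M, ∀ᶠ i in l, f i ≤ h M i)
    (hg : ∀ M, Tendsto (g M) l (𝓝 (a M))) (hh : ∀ M, Tendsto (h M) l (𝓝 (b M)))
    (ha : Tendsto a atTop (𝓝 x)) (hb : Tendsto b atTop (𝓝 x)) : Tendsto f l (𝓝 x) := by
  refine tendsto_order.2 ⟨fun y hy => ?_, fun y hy => ?_⟩
  · obtain ⟨M, hM⟩ := (ha.eventually_const_lt hy).exists
    filter_upwards [hgf M, (hg M).eventually_const_lt hM] with i hi hyi using hyi.trans_le hi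
  · obtain ⟨M, hM⟩ := (hb.eventually_lt_const hy).exists
    filter_upwards [hfh M, (hh M).eventually_lt_const hM] with i hi hyi using hi.trans_lt hyi

variable {ι α : Type*} [DecidableEq ι]

lemma forall_mem_update_univ_iff (x : ι → α) (i : ι) (A : Set α) :
    (∀ k, x k ∈ Function.update (fun _ => Set.univ) i A k) ↔ x i ∈ A := by
  rw [Function.forall_update_iff _ fun k s => x k ∈ s]
  simp

/-- Setting all but one of the `A i` to `univ` turns joint limits into marginal limits. -/
lemma tendsto_sub_prod_update_univ [Fintype ι] {F : ℕ → (ι → Set α) → ℝ} {p : Set α → ℝ}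
    (hp : p Set.univ = 1) (hF : ∀ A, Tendsto (fun N => F N A) atTop (𝓝 (∏ i, p (A i))))
    (A : ι → Set α) :
    Tendsto (fun N => F N A - ∏ i, F N (Function.update (fun _ => Set.univ) i (A i)))
      atTop (𝓝 0) := by
  rw [← sub_self (∏ i, p (A i))]
  refine (hF A).sub (tendsto_finsetProd _ fun i _ => ?_)
  convert hF (Function.update (fun _ => Set.univ) i (A i)) using 2
  rw [Finset.prod_eq_single i (fun k _ hk => by rw [Function.update_of_ne hk, hp]) (by simp),
    Function.update_self]

end ProductLimit

lemma prob_le_prob_inter_add {θ κ : ℕ → ℝ} {N : ℕ} (hθ : ∀ j, 1 ≤ j → 0 ≤ θ j)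
    (hκ : ∀ j, 1 ≤ j → 0 ≤ κ j) (hpos : 0 < normConst θ κ N) (A B : Set (Equiv.Perm (Fin N))) :
    prob θ κ N A ≤ prob θ κ N (A ∩ B) + (1 - prob θ κ N B) := by
  classical
  rw [← prob_univ hpos]
  simp only [prob_eq_mean, ← map_sub, ← map_add]
  refine mean_mono hθ hκ fun σ => ?_
  by_cases hA : σ ∈ A <;> by_cases hB : σ ∈ B <;> simp [hA, hB]

namespace Admissible

variable {θ κ : ℕ → ℝ} {r : ℝ} {m : ℕ}

lemma tendsto_prob_lexLength_mem_finset (h : Admissible θ κ r) (A : Fin m → Finset ℕ) :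
    Tendsto (fun N : ℕ => prob θ κ N {σ | ∀ i : Fin m, lexLength σ i ∈ A i})
      atTop (𝓝 (∏ i, ∑ j ∈ A i, limitWeight κ r j)) := by
  rw [Finset.prod_univ_sum]
  refine (tendsto_finsetSum _ fun ℓ _ => h.tendsto_prob_lexLength_eq ℓ).congr fun N => ?_
  have hlaw := prob_setOf_mem_finset θ κ (fun (σ : Equiv.Perm (Fin N)) (i : Fin m) =>
    lexLength σ i) (Fintype.piFinset A)
  simpa only [Fintype.mem_piFinset, funext_iff] using hlaw.symm

lemma sum_range_limitWeight_pos (h : Admissible θ κ r) {M : ℕ}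
    (hM : ∃ j, 1 ≤ j ∧ j ≤ M ∧ 0 < κ j) : 0 < ∑ j ∈ Finset.range (M + 1), limitWeight κ r j := by
  obtain ⟨j, hj, hjM, hκj⟩ := hM
  refine Finset.sum_pos' (fun i _ => h.limitWeight_nonneg i)
    ⟨j, Finset.mem_range.2 (Nat.lt_succ_of_le hjM), ?_⟩
  rw [limitWeight_of_ne_zero (Nat.ne_of_gt hj)]
  exact mul_pos hκj (pow_pos h.pos j)

lemma tendsto_condProb_lexLength_mem (h : Admissible θ κ r) {M : ℕ}
    (hM : ∃ j, 1 ≤ j ∧ j ≤ M ∧ 0 < κ j) (A : Fin m → Set ℕ) :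
    Tendsto (fun N : ℕ => condProb θ κ N {σ | ∀ i : Fin m, lexLength σ i ∈ A i}
        {σ | ∀ i : Fin m, lexLength σ i ≤ M})
      atTop (𝓝 (∏ i, (∑ j ∈ Finset.range (M + 1), (A i).indicator (limitWeight κ r) j) /
        ∑ j ∈ Finset.range (M + 1), limitWeight κ r j)) := by
  classical
  simp only [Finset.prod_div_distrib, Set.indicator_apply, ← Finset.sum_filter]
  refine ((h.tendsto_prob_lexLength_mem_finset _).div
    (h.tendsto_prob_lexLength_mem_finset fun _ => Finset.range (M + 1))
    (Finset.prod_pos fun _ _ => h.sum_range_limitWeight_pos hM).ne').congr fun N => ?_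
  rw [condProb, Pi.div_apply]
  simp only [Finset.mem_filter, Finset.mem_range, Nat.lt_succ_iff, forall_and, and_comm,
    ← Set.ofPred_and]

lemma tendsto_condProb_sub_prod (h : Admissible θ κ r) {M : ℕ}
    (hM : ∃ j, 1 ≤ j ∧ j ≤ M ∧ 0 < κ j) (A : Fin m → Set ℕ) :
    Tendsto (fun N : ℕ =>
      condProb θ κ N {σ | ∀ i : Fin m, lexLength σ i ∈ A i} {σ | ∀ k : Fin m, lexLength σ k ≤ M} -
        ∏ i : Fin m, condProb θ κ N {σ | lexLength σ i ∈ A i}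
          {σ | ∀ k : Fin m, lexLength σ k ≤ M}) atTop (𝓝 0) := by
  have hp : (∑ j ∈ Finset.range (M + 1), Set.univ.indicator (limitWeight κ r) j) /
      ∑ j ∈ Finset.range (M + 1), limitWeight κ r j = 1 := by
    rw [Set.indicator_univ, div_self (h.sum_range_limitWeight_pos hM).ne']
  simpa only [forall_mem_update_univ_iff] using tendsto_sub_prod_update_univ
    (F := fun N A => condProb θ κ N {σ | ∀ i : Fin m, lexLength σ i ∈ A i}
      {σ | ∀ k : Fin m, lexLength σ k ≤ M})
    (p := fun A => (∑ j ∈ Finset.range (M + 1), A.indicator (limitWeight κ r) j) /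
      ∑ j ∈ Finset.range (M + 1), limitWeight κ r j) hp (h.tendsto_condProb_lexLength_mem hM) A

/-- As the limit has total mass `1`, no mass escapes to infinity and the `A i` may be truncated. -/
lemma tendsto_prob_lexLength_mem (h : Admissible θ κ r) (hsum : HasSum (limitWeight κ r) 1)
    (A : Fin m → Set ℕ) :
    Tendsto (fun N : ℕ => prob θ κ N {σ | ∀ i : Fin m, lexLength σ i ∈ A i})
      atTop (𝓝 (∏ i, ∑' j, (A i).indicator (limitWeight κ r) j)) := by
  classical
  have hlow : Tendsto (fun M => ∏ i, ∑ j ∈ Finset.range M with j ∈ A i, limitWeight κ r j) atTop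
      (𝓝 (∏ i, ∑' j, (A i).indicator (limitWeight κ r) j)) :=
    tendsto_finsetProd _ fun i _ => by
      simpa only [Finset.sum_filter, Set.indicator_apply] using
        (hsum.summable.indicator (A i)).hasSum.tendsto_sum_nat
  have hescape : Tendsto (fun M => 1 - ∏ _i : Fin m, ∑ j ∈ Finset.range M, limitWeight κ r j)
      atTop (𝓝 0) := by
    simpa using (hsum.tendsto_sum_nat.pow m).const_sub 1
  have hcut M := h.tendsto_prob_lexLength_mem_finset fun i => (Finset.range M).filter (· ∈ A i)
  refine tendsto_of_eventually_between (fun M => Eventually.of_forall fun N => ?_) (fun M => ?_)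
    hcut
    (fun M => (hcut M).add
      ((h.tendsto_prob_lexLength_mem_finset fun _ => Finset.range M).const_sub 1))
    hlow (by simpa using hlow.add hescape)
  · exact prob_mono h.θ_nonneg h.κ_nonneg fun σ hσ i => (Finset.mem_filter.1 (hσ i)).2
  · filter_upwards [eventually_normConst_pos h.θ_nonneg h.κ_nonneg h.nonArithmetic] with N hpos
    refine (prob_le_prob_inter_add h.θ_nonneg h.κ_nonneg hpos _ _).trans
      (add_le_add_left (prob_mono h.θ_nonneg h.κ_nonneg fun σ hσ i => ?_) _)
    exact Finset.mem_filter.2 ⟨hσ.2 i, hσ.1 i⟩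

lemma tendsto_prob_sub_prod (h : Admissible θ κ r) (hsum : HasSum (limitWeight κ r) 1)
    (A : Fin m → Set ℕ) :
    Tendsto (fun N : ℕ => prob θ κ N {σ | ∀ i : Fin m, lexLength σ i ∈ A i} -
      ∏ i : Fin m, prob θ κ N {σ | lexLength σ i ∈ A i}) atTop (𝓝 0) := by
  have hp : ∑' j, (Set.univ : Set ℕ).indicator (limitWeight κ r) j = 1 := by
    rw [Set.indicator_univ, hsum.tsum_eq]
  simpa only [forall_mem_update_univ_iff] using tendsto_sub_prod_update_univ
    (F := fun N A => prob θ κ N {σ | ∀ i : Fin m, lexLength σ i ∈ A i})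
    (p := fun A => ∑' j, A.indicator (limitWeight κ r) j) hp
    (h.tendsto_prob_lexLength_mem hsum) A

end Admissible

lemma hasSum_prod_pow {ι : Type*} {f : ι → ℝ} (hf : ∀ x, 0 ≤ f x) {S : ℝ} (h : HasSum f S)
    (m : ℕ) : HasSum (fun ℓ : Fin m → ι => ∏ i, f (ℓ i)) (S ^ m) := by
  induction m with
  | zero => simp
  | succ m ih =>
    have hsummable := h.summable.mul_of_nonneg ih.summable hf
      fun ℓ => Finset.prod_nonneg fun i _ => hf (ℓ i)
    have hmul := h.mul ih hsummable
    rw [← (Fin.consEquiv fun _ : Fin (m + 1) => ι).hasSum_iff, pow_succ']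
    refine hmul.congr_fun fun p => ?_
    simp [Fin.consEquiv, Fin.prod_univ_succ]

end SurrogateSpatial

end

open SurrogateSpatial in
theorem mainTheorem8_general (θ κ : ℕ → ℝ)
    (hθ : ∀ j : ℕ, 1 ≤ j → 0 ≤ θ j) (hκ : ∀ j : ℕ, 1 ≤ j → 0 ≤ κ j)
    (hna : NonArithmetic κ) (hR : 0 < genRadius κ)
    (hrθ : ∀ r : ℝ, IsRStar κ r → ENNReal.ofReal r ≤ genRadius θ) :
    (∀ᶠ N : ℕ in atTop, 0 < normConst θ κ N) ∧
    ∃ r : ℝ, (IsRStar κ r ∧ ∀ r' : ℝ, IsRStar κ r' → r' = r) ∧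
      ∀ m : ℕ, 1 ≤ m →
        (∀ ℓ : Fin m → ℕ+, Tendsto
          (fun N : ℕ => prob θ κ N
            {σ | ∀ i : Fin m, lexLength σ i = (ℓ i : ℕ)})
          atTop (𝓝 (∏ i : Fin m, κ (ℓ i : ℕ) * r ^ (ℓ i : ℕ)))) ∧
        (∀ M : ℕ, (∃ j : ℕ, 1 ≤ j ∧ j ≤ M ∧ 0 < κ j) → ∀ ℓ : Fin m → ℕ+, Tendsto
          (fun N : ℕ =>
            condProb θ κ N
                {σ | ∀ i : Fin m, lexLength σ i = (ℓ i : ℕ)}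
                {σ | ∀ i : Fin m, lexLength σ i ≤ M}
              - ∏ i : Fin m, condProb θ κ N
                  {σ | lexLength σ i = (ℓ i : ℕ)}
                  {σ | ∀ k : Fin m, lexLength σ k ≤ M})
          atTop (𝓝 0)) ∧
        (1 ≤ modDeriv κ 1 (genRadius κ) →
          HasSum (fun ℓ : Fin m → ℕ+ => ∏ i : Fin m, κ (ℓ i : ℕ) * r ^ (ℓ i : ℕ)) 1 ∧
          ∀ A : Fin m → Set ℕ, Tendsto
            (fun N : ℕ =>
              prob θ κ N {σ | ∀ i : Fin m, lexLength σ i ∈ A i}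
                - ∏ i : Fin m, prob θ κ N
                    {σ | lexLength σ i ∈ A i})
            atTop (𝓝 0)) ∧
        (modDeriv κ 1 (genRadius κ) < 1 →
          HasSum (fun ℓ : Fin m → ℕ+ => ∏ i : Fin m, κ (ℓ i : ℕ) * r ^ (ℓ i : ℕ))
            ((modDeriv κ 1 (genRadius κ)).toReal ^ m) ∧
          (modDeriv κ 1 (genRadius κ)).toReal ^ m < 1) := by
  obtain ⟨r, hr⟩ := exists_isRStar hκ (NonArithmetic.exists_pos hκ hna) hR
  have h : Admissible θ κ r := ⟨hθ, hκ, hna, hr, hrθ r hr⟩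
  have hmass {S : ℝ} (hS : HasSum (limitWeight κ r) S) (m : ℕ) :
      HasSum (fun ℓ : Fin m → ℕ+ => ∏ i, κ (ℓ i) * r ^ (ℓ i : ℕ)) (S ^ m) :=
    hasSum_prod_pow (fun j : ℕ+ => mul_nonneg (hκ j j.2) (pow_nonneg h.pos.le _))
      (hasSum_pnat_of_hasSum_limitWeight hS) m
  refine ⟨eventually_normConst_pos hθ hκ hna, r, ⟨hr, fun r' hr' => hr.unique hκ hr'⟩,
    fun m hm => ⟨fun ℓ => ?_, fun M hM ℓ => ?_, fun hproper => ?_, fun hdefective => ⟨?_, ?_⟩⟩⟩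
  · simpa only [limitWeight_of_ne_zero (PNat.ne_zero _)] using
      h.tendsto_prob_lexLength_eq fun i => (ℓ i : ℕ)
  · exact h.tendsto_condProb_sub_prod hM fun i => {(ℓ i : ℕ)}
  · have hsum : HasSum (limitWeight κ r) 1 := by
      simpa only [hr.2.2.1 hproper, ENNReal.toReal_one] using h.hasSum_limitWeight
    exact ⟨by simpa only [one_pow] using hmass hsum m, h.tendsto_prob_sub_prod hsum⟩
  · simpa only [hr.2.2.2 hdefective] using hmass h.hasSum_limitWeight m
  · refine pow_lt_one₀ ENNReal.toReal_nonneg ?_ (Nat.ne_of_gt hm)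
    exact ENNReal.toReal_lt_of_lt_ofReal (by rwa [ENNReal.ofReal_one])

theorem mainTheorem8 (θ κ : ℕ → ℝ)
    (hθ : ∀ j : ℕ, 1 ≤ j → 0 ≤ θ j) (hκ : ∀ j : ℕ, 1 ≤ j → 0 ≤ κ j)
    (hna : SurrogateSpatial.NonArithmetic κ) (hnd : ∃ j : ℕ, 2 ≤ j ∧ 0 < κ j)
    (han : SurrogateSpatial.AnalyticConditions θ κ) :
    -- for all large `N` the measure is well defined
    (∀ᶠ N : ℕ in atTop, 0 < SurrogateSpatial.normConst θ κ N) ∧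
    -- `r` is the uniquely determined number `r_*`
    ∃ r : ℝ, (SurrogateSpatial.IsRStar κ r ∧ ∀ r' : ℝ, SurrogateSpatial.IsRStar κ r' → r' = r) ∧
      ∀ m : ℕ, 1 ≤ m →
        -- the limit of the joint distribution of `L_1, …, L_m`
        (∀ ℓ : Fin m → ℕ+, Tendsto
          (fun N : ℕ => SurrogateSpatial.prob θ κ N
            {σ | ∀ i : Fin m, SurrogateSpatial.lexLength σ i = (ℓ i : ℕ)})
          atTop (𝓝 (∏ i : Fin m, κ (ℓ i : ℕ) * r ^ (ℓ i : ℕ)))) ∧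
        -- asymptotic independence, conditionally on `L_1 ≤ M, …, L_m ≤ M`
        (∀ M : ℕ, (∃ j : ℕ, 1 ≤ j ∧ j ≤ M ∧ 0 < κ j) → ∀ ℓ : Fin m → ℕ+, Tendsto
          (fun N : ℕ =>
            SurrogateSpatial.condProb θ κ N
                {σ | ∀ i : Fin m, SurrogateSpatial.lexLength σ i = (ℓ i : ℕ)}
                {σ | ∀ i : Fin m, SurrogateSpatial.lexLength σ i ≤ M}
              - ∏ i : Fin m, SurrogateSpatial.condProb θ κ N
                  {σ | SurrogateSpatial.lexLength σ i = (ℓ i : ℕ)}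
                  {σ | ∀ k : Fin m, SurrogateSpatial.lexLength σ k ≤ M})
          atTop (𝓝 0)) ∧
        -- subcritical and critical cases: proper limit, unconditional asymptotic independence
        (1 ≤ SurrogateSpatial.modDeriv κ 1 (SurrogateSpatial.genRadius κ) →
          HasSum (fun ℓ : Fin m → ℕ+ => ∏ i : Fin m, κ (ℓ i : ℕ) * r ^ (ℓ i : ℕ)) 1 ∧
          ∀ A : Fin m → Set ℕ, Tendsto
            (fun N : ℕ =>
              SurrogateSpatial.prob θ κ N {σ | ∀ i : Fin m, SurrogateSpatial.lexLength σ i ∈ A i}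
                - ∏ i : Fin m, SurrogateSpatial.prob θ κ N
                    {σ | SurrogateSpatial.lexLength σ i ∈ A i})
            atTop (𝓝 0)) ∧
        -- supercritical case: defective limit
        (SurrogateSpatial.modDeriv κ 1 (SurrogateSpatial.genRadius κ) < 1 →
          HasSum (fun ℓ : Fin m → ℕ+ => ∏ i : Fin m, κ (ℓ i : ℕ) * r ^ (ℓ i : ℕ))
            ((SurrogateSpatial.modDeriv κ 1 (SurrogateSpatial.genRadius κ)).toReal ^ m) ∧
          (SurrogateSpatial.modDeriv κ 1 (SurrogateSpatial.genRadius κ)).toReal ^ m < 1) :=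
  let hrad := han.genRadius_pos_and_le
  mainTheorem8_general θ κ hθ hκ hna hrad.1 fun _ hr => hr.2.1.trans hrad.2
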